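/- **Setting.** Let $(\mathbb S,\mathbb P)$ be a probability space of data samples and, for each $\xi\in\mathbb S$, let $f_\xi:\mathbb R^d\to\mathbb R$ be differentiable, with $\xi\mapsto f_\xi(w)$ measurable and $\mathbb P$-integrable for every $w$ and with $\|\nabla f_\xi\|$ continuous along every line segment. Let $f(w)=\mathbb E_{\xi\sim\mathbb P}f_\xi(w)$ be differentiable and bounded below, and put $f^*=\inf_w f(w)$. Let $\alpha\in(0,1]$ and $L_0,L_1,\Gamma,\Lambda>0$. Assume that for all $w,w'\in\mathbb R^d$, with $w_\theta=\theta w'+(1-\theta)w$ (all expectations being finite), $$\mathbb E_\xi\|\nabla f_\xi(w')-\nabla f_\xi(w)\|^2\le\|w'-w\|^2\,\mathbb E_\xi\Big(L_0+L_1\max_{\theta\in[0,1]}\|\nabla f_\xi(w_\theta)\|^\alpha\Big)^2$$ (that is, $f$ belongs to the expected $\alpha$-symmetric generalized-smooth class with constants $L_0,L_1$), and that for all $w$ $$\mathbb E_\xi\nabla f_\xi(w)=\nabla f(w),\qquad \mathbb E_\xi\|\nabla f_\xi(w)-\nabla f(w)\|^2\le\Gamma^2\|\nabla f(w)\|^2+\Lambda^2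 .$$ **Algorithm (SPIDER).** Let $q,K\ge 1$ be integers and $T=qK$. All samples in the minibatches $S_0,S_1,\dots$ are i.i.d. with law $\mathbb P$; $|S_t|=B$ if $t\bmod q=0$ and $|S_t|=B'$ otherwise; the initial point $w_0$ (possibly random) is independent of the samples and $f(w_0)$ is integrable. With $\nabla f_{S}(w)=\frac1{|S|}\sum_{\xi\in S}\nabla f_\xi(w)$, for $t=0,\dots,T-1$ let $v_t=\nabla f_{S_t}(w_t)$ if $t\bmod q=0$ and $v_t=v_{t-1}+\nabla f_{S_t}(w_t)-\nabla f_{S_t}(w_{t-1})$ otherwise, and $w_{t+1}=w_t-\gamma v_t/\|v_t\|$ (with $w_{t+1}=w_t$ if $v_t=0$). The output is $w_{\widetilde T}$, where $\widetilde T$ is uniform on $\{0,\dots,T-1\}$ and independent of everything else. **Stepsize.** For the target accuracy $\epsilon\in(0,1)$ let $$\gamma=\frac{\epsilon}{2\overline K_0+4\overline K_2+2\overline K_1(\Lambda^\alpha+\Gamma^\alpha+1)+1}\ \ (0<\alpha<1),\qquad \gamma=\frac{\epsilon}{5L_1\sqrt{\Gamma^2+1}+8\sqrt{L_0^2+2L_1^2\Lambda^2}}\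 \ (\alpha=1),$$ where $\overline K_0=2^{\frac{2-\alpha}{1-\alpha}}L_0$, $\overline K_1=2^{\frac{2-\alpha}{1-\alpha}}L_1$, $\overline K_2=(5L_1)^{\frac1{1-\alpha}}$. **Theorem (Convergence of SPIDER).** (i) If $$B\ge\max(576\Lambda^2\epsilon^{-2},\,2304\Gamma^2q^2),\qquad B'\ge\max(576q,\,2304q^2\epsilon^2),\tag{1}$$ then for every $K\ge1$ the expectation $\mathbb E\|\nabla f(w_{\widetilde T})\|$ is finite and $$\mathbb E\|\nabla f(w_{\widetilde T})\|\le\frac{16}{5T\gamma}\big(\mathbb Ef(w_0)-f^*\big)+\frac{4\epsilon}5 .$$ (ii) For every $\Delta\in\mathbb R$ there is a constant $C>0$ depending only on $\alpha,L_0,L_1,\Gamma,\Lambda,\Delta$ such that for every $\epsilon\in(0,1)$ there are integers $q,B,B',K$ with $q,K\ge1$ satisfying (1), $$B\le C\epsilon^{-2},\quad B'\le C\epsilon^{-1},\quad q\le C\epsilon^{-1},\quad \gamma\le C\epsilon,\quad T=qK\le C\epsilon^{-2},$$ whose total number of samples satisfies $\sum_{t=0}^{T-1}|S_t|\le C\epsilon^{-3}$,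 and for which $\mathbb E\|\nabla f(w_{\widetilde T})\|\le\epsilon$ (the expectation being finite) for every problem and initial point as above with $\mathbb Ef(w_0)-f^*\le\Delta$. -/

import Mathlib

open MeasureTheory ProbabilityTheory

noncomputable section

/-- The population loss `f(w) = E_{ξ ∼ P} f_ξ(w)`; `F ξ` is the loss `f_ξ` of the sample `ξ`. -/
def popLoss {d : ℕ} {S : Type*} [MeasurableSpace S] (P : Measure S)
    (F : S → EuclideanSpace ℝ (Fin d) → ℝ) (w : EuclideanSpace ℝ (Fin d)) : ℝ :=
  ∫ ξ, F ξ w ∂P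

/-- The point `w_θ = θ w' + (1 - θ) w` of the line segment from `w` to `w'`. -/
def segPoint {d : ℕ} (w w' : EuclideanSpace ℝ (Fin d)) (θ : ℝ) : EuclideanSpace ℝ (Fin d) :=
  θ • w' + (1 - θ) • w

/-- `f = E f_ξ` belongs to the expected `α`-symmetric generalized-smooth class, with the
constants `L₀, L₁`. The sample losses and `f` are differentiable, the expectations in the
defining inequality are finite, and `‖∇f_ξ‖` is continuous along every line segment, so that the
supremum over `θ ∈ [0, 1]` is a maximum. -/
structure IsExpectedSymSmooth {d : ℕ} {S : Type*} [MeasurableSpace S] (P : Measure S)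
    (F : S → EuclideanSpace ℝ (Fin d) → ℝ) (α L₀ L₁ : ℝ) : Prop where
  measurable_sample : ∀ w, Measurable (fun ξ => F ξ w)
  integrable_sample : ∀ w, Integrable (fun ξ => F ξ w) P
  differentiable_sample : ∀ ξ, Differentiable ℝ (F ξ)
  differentiable_popLoss : Differentiable ℝ (popLoss P F)
  continuous_segment : ∀ ξ w w',
    ContinuousOn (fun θ : ℝ => ‖gradient (F ξ) (segPoint w w' θ)‖) (Set.Icc 0 1)
  integrable_left : ∀ w w',
    Integrable (fun ξ => ‖gradient (F ξ) w' - gradient (F ξ) w‖ ^ 2) P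
  integrable_right : ∀ w w',
    Integrable (fun ξ => (L₀ + L₁ *
      ⨆ θ : Set.Icc (0 : ℝ) 1, ‖gradient (F ξ) (segPoint w w' (θ : ℝ))‖ ^ α) ^ 2) P
  smooth : ∀ w w',
    ∫ ξ, ‖gradient (F ξ) w' - gradient (F ξ) w‖ ^ 2 ∂P ≤
      ‖w' - w‖ ^ 2 * ∫ ξ, (L₀ + L₁ *
        ⨆ θ : Set.Icc (0 : ℝ) 1, ‖gradient (F ξ) (segPoint w w' (θ : ℝ))‖ ^ α) ^ 2 ∂P

/-- The stochastic gradient is unbiased and its variance at `w` is at most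
`Γ² ‖∇f(w)‖² + Λ²`. -/
structure HasUnbiasedBoundedVariance {d : ℕ} {S : Type*} [MeasurableSpace S] (P : Measure S)
    (F : S → EuclideanSpace ℝ (Fin d) → ℝ) (Γ Λ : ℝ) : Prop where
  integrable_gradient : ∀ w, Integrable (fun ξ => gradient (F ξ) w) P
  unbiased : ∀ w, ∫ ξ, gradient (F ξ) w ∂P = gradient (popLoss P F) w
  integrable_sq : ∀ w,
    Integrable (fun ξ => ‖gradient (F ξ) w - gradient (popLoss P F) w‖ ^ 2) P
  variance_le : ∀ w,
    ∫ ξ, ‖gradient (F ξ) w - gradient (popLoss P F) w‖ ^ 2 ∂P ≤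
      Γ ^ 2 * ‖gradient (popLoss P F) w‖ ^ 2 + Λ ^ 2

/-- The minibatch size `|S_t|`: `B` when `t mod q = 0` and `B'` otherwise. -/
def batchSize (q B B' t : ℕ) : ℕ := if t % q = 0 then B else B'

/-- The minibatch gradient `(1/n) ∑_{i < n} ∇f_{s i}(w)`. -/
def batchGradient {d : ℕ} {S : Type*} (F : S → EuclideanSpace ℝ (Fin d) → ℝ) (s : ℕ → S) (n : ℕ)
    (w : EuclideanSpace ℝ (Fin d)) : EuclideanSpace ℝ (Fin d) :=
  (n : ℝ)⁻¹ • ∑ i ∈ Finset.range n, gradient (F (s i)) w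

/-- The SPIDER iteration on the data `s` (`s t i` is the `i`-th sample of the minibatch `S_t`):
the pair `(w_t, v_t)`. The iterate stays put when the search direction is zero. -/
def spider {d : ℕ} {S : Type*} (F : S → EuclideanSpace ℝ (Fin d) → ℝ) (γ : ℝ) (q B B' : ℕ)
    (w₀ : EuclideanSpace ℝ (Fin d)) (s : ℕ → ℕ → S) :
    ℕ → EuclideanSpace ℝ (Fin d) × EuclideanSpace ℝ (Fin d)
  | 0 => (w₀, batchGradient F (s 0) (batchSize q B B' 0) w₀)
  | t + 1 =>
    let w := (spider F γ q B B' w₀ s t).1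
    let v := (spider F γ q B B' w₀ s t).2
    let w' := w - γ • (‖v‖⁻¹ • v)
    (w',
      if (t + 1) % q = 0 then
        batchGradient F (s (t + 1)) (batchSize q B B' (t + 1)) w'
      else
        v + batchGradient F (s (t + 1)) (batchSize q B B' (t + 1)) w'
          - batchGradient F (s (t + 1)) (batchSize q B B' (t + 1)) w)

/-- The random input of a run with `T` iterations: i.i.d. samples with law `P`, an initial point
independent of them, and an output index uniform on `{0, …, T - 1}` and independent of both. -/
structure IsRandomInput {d : ℕ} {S Ω : Type*} [MeasurableSpace S] [MeasurableSpace Ω]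
    (P : Measure S) (μ : Measure Ω) (W₀ : Ω → EuclideanSpace ℝ (Fin d)) (ξ : ℕ → ℕ → Ω → S)
    (τ : Ω → ℕ) (T : ℕ) : Prop where
  measurable_sample : ∀ t i, Measurable (ξ t i)
  law_sample : ∀ t i, μ.map (ξ t i) = P
  indep_sample : iIndepFun (fun p : ℕ × ℕ => ξ p.1 p.2) μ
  measurable_init : Measurable W₀
  indep_init : IndepFun W₀ (fun ω (p : ℕ × ℕ) => ξ p.1 p.2 ω) μ
  measurable_index : Measurable τ
  uniform_index : ∀ t < T, μ {ω | τ ω = t} = (T : ENNReal)⁻¹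
  indep_index : IndepFun τ (fun ω => (W₀ ω, fun p : ℕ × ℕ => ξ p.1 p.2 ω)) μ

/-- The stepsize. -/
def spiderStepsize (α L₀ L₁ Γ Λ ε : ℝ) : ℝ :=
  if α = 1 then
    ε / (5 * L₁ * √(Γ ^ 2 + 1) + 8 * √(L₀ ^ 2 + 2 * L₁ ^ 2 * Λ ^ 2))
  else
    let K₀ : ℝ := 2 ^ ((2 - α) / (1 - α)) * L₀
    let K₁ : ℝ := 2 ^ ((2 - α) / (1 - α)) * L₁
    let K₂ : ℝ := (5 * L₁) ^ (1 / (1 - α))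
    ε / (2 * K₀ + 4 * K₂ + 2 * K₁ * (Λ ^ α + Γ ^ α + 1) + 1)

end

/-! Every step has length at most γ, so only the smoothness of the losses on balls of radius γ
matters. Let u(θ) be the L² distance between the sample gradients at w and at w_θ. Applying the
smoothness hypothesis to shrinking subsegments replaces the segment maximum by its value at one
point. Jensen's inequality (x ↦ (L₀ + L₁ x^(α/2))² is concave for α ≤ 1) then bounds the right slope
of u by ‖w' - w‖ (L₀ + L₁ (m + u)^α), where m is the L² norm of the sample gradient at w. A Grönwall
comparison (`gradDist_le_of_fixed_bound`) yields an L² Lipschitz constant M, and the stepsize is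
such that γ M ≤ ε/4 · (1 + ‖∇f(w)‖) (`gradDist_le_of_le_stepsize`).

This gives two things. A normalized step along v lowers f by γ‖∇f‖, up to 2γ‖v - ∇f‖ and γ ε/8 · (1
+ ‖∇f‖) (`normalized_step_descent`). And the noise that a correction minibatch adds to v has
conditional variance at most a² (1 + ‖∇f‖)², with a = ε / (4√B').

The error has to be controlled by first moments of ‖∇f(w_t)‖, since no second moment is available:
only f(w₀) is integrable. So the recursion runs on E√(‖v_t - ∇f(w_t)‖² + c). Going back one
iteration, the constant part a² of the variance joins c under the root, where variances add, and the
part depending on the gradient leaves the root linearly, as a‖∇f‖ (`smoothedError_succ_le`). Over an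
epoch the constants contribute only √q a, and the linear terms a sum of E‖∇f(w_t)‖
(`smoothedError_epoch_le`).

The batch sizes make the coefficients of that sum of order 1/q, so after summation over the epoch
the errors are absorbed by the decrease of f (`sum_meanGradNorm_le`). Telescoping and averaging over
the uniform index give the bound; parameters of the stated orders then give the sample complexity.
-/

noncomputable section

/-! ### L² norms and Jensen's inequality for powers at most 1. -/

section L2

open Filter Topology

variable {S : Type*} [MeasurableSpace S] {P : Measure S}
  {E : Type*} [NormedAddCommGroup E] {X : S → E}

lemma integral_norm_sq_eq_lpNorm_sq (hX : MemLp X 2 P) :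
    ∫ s, ‖X s‖ ^ 2 ∂P = lpNorm X 2 P ^ 2 := by
  rw [lpNorm_eq_integral_norm_rpow_toReal (by norm_num) (by norm_num) hX.aestronglyMeasurable]
  simp only [ENNReal.toReal_ofNat, Real.rpow_two]
  rw [← Real.rpow_natCast, ← Real.rpow_mul (by positivity)]
  norm_num

lemma memLp_two_of_integrable_norm_sq (hX : AEStronglyMeasurable X P)
    (h : Integrable (fun s => ‖X s‖ ^ 2) P) : MemLp X 2 P :=
  (memLp_two_iff_integrable_sq_norm hX).2 h

lemma integrable_norm_sq (hX : MemLp X 2 P) : Integrable (fun s => ‖X s‖ ^ 2) P :=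
  (memLp_two_iff_integrable_sq_norm hX.aestronglyMeasurable).1 hX

lemma integrable_rpow_of_le_one [IsProbabilityMeasure P] {Y : S → ℝ} (hY : Integrable Y P)
    (hY0 : ∀ s, 0 ≤ Y s) {p : ℝ} (hp0 : 0 ≤ p) (hp1 : p ≤ 1) :
    Integrable (fun s => Y s ^ p) P := by
  refine Integrable.mono' ((integrable_const (1 : ℝ)).add hY) ?_ ?_
  · exact (hY.aestronglyMeasurable.aemeasurable.pow_const p).aestronglyMeasurable
  · refine .of_forall fun s => ?_
    rw [Real.norm_of_nonneg (Real.rpow_nonneg (hY0 s) p)]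
    simp only [Pi.add_apply]
    rcases le_total (Y s) 1 with h | h
    · linarith [Real.rpow_le_one (hY0 s) h hp0, hY0 s]
    · have := Real.rpow_le_rpow_of_exponent_le h hp1
      rw [Real.rpow_one] at this
      linarith

lemma integral_rpow_le_rpow_integral [IsProbabilityMeasure P] {Y : S → ℝ} (hY : Integrable Y P)
    (hY0 : ∀ s, 0 ≤ Y s) {p : ℝ} (hp0 : 0 ≤ p) (hp1 : p ≤ 1) :
    ∫ s, Y s ^ p ∂P ≤ (∫ s, Y s ∂P) ^ p :=
  (Real.concaveOn_rpow hp0 hp1).le_map_integral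
    (Real.continuous_rpow_const hp0).continuousOn isClosed_Ici
    (.of_forall fun s => hY0 s) hY (integrable_rpow_of_le_one hY hY0 hp0 hp1)

/-- Jensen's inequality for the function `(a + b x ^ (α / 2)) ^ 2`. -/
lemma integral_add_mul_rpow_sq_le [IsProbabilityMeasure P] (hX : MemLp X 2 P) {a b α : ℝ}
    (ha : 0 ≤ a) (hb : 0 ≤ b) (hα0 : 0 ≤ α) (hα1 : α ≤ 1) :
    ∫ s, (a + b * ‖X s‖ ^ α) ^ 2 ∂P ≤ (a + b * lpNorm X 2 P ^ α) ^ 2 := by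
  have hi := integrable_norm_sq hX
  have hn : ∀ s, 0 ≤ ‖X s‖ ^ 2 := fun s => by positivity
  -- With y = ‖X‖² the expanded square is a² + 2ab y^(α/2) + b² y^α. Both exponents lie in [0, 1],
  -- so Jensen's inequality applies term by term.
  have key : ∀ x : ℝ, 0 ≤ x → (x ^ 2) ^ (α / 2) = x ^ α ∧ (x ^ 2) ^ α = (x ^ α) ^ 2 := by
    intro x hx
    constructor
    · rw [← Real.rpow_natCast, ← Real.rpow_mul hx]; congr 1; push_cast; ring
    · rw [← Real.rpow_natCast, ← Real.rpow_mul hx, ← Real.rpow_natCast, ← Real.rpow_mul hx,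
        mul_comm]
  have i1 := integrable_rpow_of_le_one hi hn (by linarith : 0 ≤ α / 2) (by linarith)
  have i2 := integrable_rpow_of_le_one hi hn hα0 hα1
  have j1 := integral_rpow_le_rpow_integral hi hn (by linarith : 0 ≤ α / 2) (by linarith)
  have j2 := integral_rpow_le_rpow_integral hi hn hα0 hα1
  simp only [fun s => (key ‖X s‖ (norm_nonneg _)).1, fun s => (key ‖X s‖ (norm_nonneg _)).2,
    integral_norm_sq_eq_lpNorm_sq hX, (key _ (lpNorm_nonneg (f := X) (p := 2) (μ := P))).1,
    (key _ (lpNorm_nonneg (f := X) (p := 2) (μ := P))).2] at i1 i2 j1 j2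
  have : ∀ s, (a + b * ‖X s‖ ^ α) ^ 2 =
      a ^ 2 + 2 * a * b * ‖X s‖ ^ α + b ^ 2 * (‖X s‖ ^ α) ^ 2 := fun s => by ring
  simp_rw [this]
  have i3 : Integrable (fun s => a ^ 2 + 2 * a * b * ‖X s‖ ^ α) P :=
    (integrable_const _).add (i1.const_mul _)
  rw [integral_add i3 (i2.const_mul _), integral_add (integrable_const _) (i1.const_mul _),
    integral_const_mul, integral_const_mul]
  simp only [integral_const, probReal_univ, one_smul]
  have h1 := mul_le_mul_of_nonneg_left j1 (by positivity : 0 ≤ 2 * a * b)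
  have h2 := mul_le_mul_of_nonneg_left j2 (by positivity : 0 ≤ b ^ 2)
  linarith

end L2

/-! ### Line segments and the maximum of the gradient norm along them. -/

section SegPoint

variable {d : ℕ} (w w' : EuclideanSpace ℝ (Fin d))

lemma segPoint_segPoint (x z θ : ℝ) :
    segPoint (segPoint w w' x) (segPoint w w' z) θ = segPoint w w' (x + θ * (z - x)) := by
  simp only [segPoint]
  module

@[simp] lemma segPoint_zero : segPoint w w' 0 = w := by simp [segPoint]

@[simp] lemma segPoint_one : segPoint w w' 1 = w' := by simp [segPoint]

lemma segPoint_sub_segPoint (x z : ℝ) :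
    segPoint w w' z - segPoint w w' x = (z - x) • (w' - w) := by
  simp only [segPoint]
  module

end SegPoint

section SegMax

open Filter Topology

variable {d : ℕ} {S : Type*}

/-- The maximum of `‖∇f_ξ‖ ^ α` over the segment from `w` to `w'`. -/
def segMax (F : S → EuclideanSpace ℝ (Fin d) → ℝ) (α : ℝ) (ξ : S)
    (w w' : EuclideanSpace ℝ (Fin d)) : ℝ :=
  ⨆ θ : Set.Icc (0 : ℝ) 1, ‖gradient (F ξ) (segPoint w w' (θ : ℝ))‖ ^ α

variable {F : S → EuclideanSpace ℝ (Fin d) → ℝ} {α L₀ L₁ : ℝ}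

lemma segMax_nonneg (ξ : S) (w w' : EuclideanSpace ℝ (Fin d)) : 0 ≤ segMax F α ξ w w' :=
  Real.iSup_nonneg fun _ => by positivity

variable [MeasurableSpace S] {P : Measure S}

namespace IsExpectedSymSmooth

lemma continuousOn_rpow (h : IsExpectedSymSmooth P F α L₀ L₁) (hα : 0 < α) (ξ : S)
    (w w' : EuclideanSpace ℝ (Fin d)) :
    ContinuousOn (fun θ : ℝ => ‖gradient (F ξ) (segPoint w w' θ)‖ ^ α) (Set.Icc 0 1) :=
  (h.continuous_segment ξ w w').rpow_const fun _ _ => Or.inr hα.le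

lemma bddAbove_segment (h : IsExpectedSymSmooth P F α L₀ L₁) (hα : 0 < α) (ξ : S)
    (w w' : EuclideanSpace ℝ (Fin d)) :
    BddAbove (Set.range fun θ : Set.Icc (0 : ℝ) 1 =>
      ‖gradient (F ξ) (segPoint w w' (θ : ℝ))‖ ^ α) := by
  have := isCompact_Icc.bddAbove_image (h.continuousOn_rpow hα ξ w w')
  rwa [Set.image_eq_range] at this

lemma rpow_le_segMax (h : IsExpectedSymSmooth P F α L₀ L₁) (hα : 0 < α) (ξ : S)
    (w w' : EuclideanSpace ℝ (Fin d)) {θ : ℝ} (hθ : θ ∈ Set.Icc (0 : ℝ) 1) :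
    ‖gradient (F ξ) (segPoint w w' θ)‖ ^ α ≤ segMax F α ξ w w' :=
  le_ciSup (h.bddAbove_segment hα ξ w w') ⟨θ, hθ⟩

lemma segMax_segPoint_le (h : IsExpectedSymSmooth P F α L₀ L₁) (hα : 0 < α) (ξ : S)
    (w w' : EuclideanSpace ℝ (Fin d)) {x z : ℝ} (hx : x ∈ Set.Icc (0 : ℝ) 1)
    (hz : z ∈ Set.Icc (0 : ℝ) 1) :
    segMax F α ξ (segPoint w w' x) (segPoint w w' z) ≤ segMax F α ξ w w' := by
  refine ciSup_le fun θ => ?_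
  rw [segPoint_segPoint]
  apply h.rpow_le_segMax hα
  obtain ⟨θ, h0, h1⟩ := θ
  constructor <;> simp only <;> nlinarith [hx.1, hx.2, hz.1, hz.2]

/-- The gradient norm is continuous along the segment, so its maximum over a subsegment shrinking to
an endpoint tends to the value there. This localizes the smoothness hypothesis. -/
lemma tendsto_segMax (h : IsExpectedSymSmooth P F α L₀ L₁) (hα : 0 < α) (ξ : S)
    (w w' : EuclideanSpace ℝ (Fin d)) {x : ℝ} (hx : x ∈ Set.Ico (0 : ℝ) 1) :
    Tendsto (fun z => segMax F α ξ (segPoint w w' x) (segPoint w w' z)) (𝓝[>] x)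
      (𝓝 (‖gradient (F ξ) (segPoint w w' x)‖ ^ α)) := by
  have hc := h.continuousOn_rpow hα ξ w w' x ⟨hx.1, hx.2.le⟩
  rw [Metric.continuousWithinAt_iff] at hc
  rw [Metric.tendsto_nhds]
  intro ε hε
  obtain ⟨δ, hδ, hc⟩ := hc (ε / 2) (half_pos hε)
  have : Set.Ioo x (min (x + δ) 1) ∈ 𝓝[>] x := Ioo_mem_nhdsGT (by simp [hδ, hx.2])
  filter_upwards [this] with z hz
  have hz1 : z < x + δ := hz.2.trans_le (min_le_left _ _)
  have hz2 : z < 1 := hz.2.trans_le (min_le_right _ _)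
  have hz0 := hz.1
  have hx0 := hx.1
  have up : segMax F α ξ (segPoint w w' x) (segPoint w w' z) ≤
      ‖gradient (F ξ) (segPoint w w' x)‖ ^ α + ε / 2 := by
    refine ciSup_le fun θ => ?_
    obtain ⟨θ, h0, h1⟩ := θ
    rw [segPoint_segPoint]
    have hy : x + θ * (z - x) ∈ Set.Icc (0 : ℝ) 1 := by constructor <;> nlinarith
    have := hc hy (by rw [Real.dist_eq, abs_lt]; constructor <;> nlinarith)
    rw [Real.dist_eq, abs_lt] at this
    linarith [this.2]
  have lo := h.rpow_le_segMax hα ξ (segPoint w w' x) (segPoint w w' z) (θ := 0) (by simp)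
  rw [segPoint_zero] at lo
  rw [Real.dist_eq, abs_lt]
  constructor <;> linarith

lemma integrable_sq_segMax (h : IsExpectedSymSmooth P F α L₀ L₁)
    (w w' : EuclideanSpace ℝ (Fin d)) :
    Integrable (fun ξ => (L₀ + L₁ * segMax F α ξ w w') ^ 2) P := h.integrable_right w w'

/-- Dominated convergence: maxima over subsegments are dominated by the maximum over the whole
segment, whose integrand is integrable by hypothesis. -/
lemma tendsto_integral_segMax (h : IsExpectedSymSmooth P F α L₀ L₁) (hα : 0 < α)
    (hL₀ : 0 < L₀) (hL₁ : 0 < L₁)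
    (w w' : EuclideanSpace ℝ (Fin d)) {x : ℝ} (hx : x ∈ Set.Ico (0 : ℝ) 1) :
    Tendsto (fun z => ∫ ξ, (L₀ + L₁ * segMax F α ξ (segPoint w w' x) (segPoint w w' z)) ^ 2 ∂P)
      (𝓝[>] x) (𝓝 (∫ ξ, (L₀ + L₁ * ‖gradient (F ξ) (segPoint w w' x)‖ ^ α) ^ 2 ∂P)) := by
  refine tendsto_integral_filter_of_dominated_convergence
    (fun ξ => (L₀ + L₁ * segMax F α ξ w w') ^ 2) ?_ ?_ (h.integrable_sq_segMax w w') ?_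
  · exact .of_forall fun z => (h.integrable_sq_segMax _ _).aestronglyMeasurable
  · filter_upwards [Ioo_mem_nhdsGT hx.2] with z hz
    refine .of_forall fun ξ => ?_
    rw [Real.norm_of_nonneg (by positivity)]
    have h1 := h.segMax_segPoint_le hα ξ w w' (x := x) (z := z) ⟨hx.1, hx.2.le⟩
      ⟨hx.1.trans hz.1.le, hz.2.le⟩
    have h2 := segMax_nonneg (F := F) (α := α) ξ (segPoint w w' x) (segPoint w w' z)
    gcongr
  · refine .of_forall fun ξ => ?_
    exact ((h.tendsto_segMax hα ξ w w' hx).const_mul L₁ |>.const_add L₀).pow 2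

end IsExpectedSymSmooth

end SegMax

/-! ### The Grönwall estimate for sample gradients in L². -/

section Gronwall

open Filter Topology

variable {d : ℕ} {S : Type*} [MeasurableSpace S] {P : Measure S}
  {F : S → EuclideanSpace ℝ (Fin d) → ℝ} {α L₀ L₁ Γ Λ : ℝ}

namespace HasUnbiasedBoundedVariance

lemma memLp_sub [IsProbabilityMeasure P] (h : HasUnbiasedBoundedVariance P F Γ Λ)
    (w : EuclideanSpace ℝ (Fin d)) :
    MemLp (fun ξ => gradient (F ξ) w - gradient (popLoss P F) w) 2 P :=
  memLp_two_of_integrable_norm_sq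
    ((h.integrable_gradient w).sub (integrable_const _)).aestronglyMeasurable (h.integrable_sq w)

lemma memLp_gradient [IsProbabilityMeasure P] (h : HasUnbiasedBoundedVariance P F Γ Λ)
    (w : EuclideanSpace ℝ (Fin d)) : MemLp (fun ξ => gradient (F ξ) w) 2 P := by
  have := (h.memLp_sub w).add (memLp_const (gradient (popLoss P F) w))
  refine this.ae_eq (.of_forall fun ξ => ?_)
  simp

end HasUnbiasedBoundedVariance

/-- The `L²` distance of the sample gradients at `w` and `w'`. -/
def gradDist (P : Measure S) (F : S → EuclideanSpace ℝ (Fin d) → ℝ)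
    (w w' : EuclideanSpace ℝ (Fin d)) : ℝ :=
  lpNorm (fun ξ => gradient (F ξ) w' - gradient (F ξ) w) 2 P

lemma gradDist_nonneg (w w' : EuclideanSpace ℝ (Fin d)) : 0 ≤ gradDist P F w w' := lpNorm_nonneg

lemma gradDist_comm (w w' : EuclideanSpace ℝ (Fin d)) :
    gradDist P F w w' = gradDist P F w' w :=
  lpNorm_sub_comm (fun ξ => gradient (F ξ) w') (fun ξ => gradient (F ξ) w) 2 P

lemma gradDist_self (w : EuclideanSpace ℝ (Fin d)) : gradDist P F w w = 0 := by
  simp [gradDist]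

variable [IsProbabilityMeasure P]

lemma gradDist_triangle (hv : HasUnbiasedBoundedVariance P F Γ Λ)
    (w w' w'' : EuclideanSpace ℝ (Fin d)) :
    gradDist P F w w'' ≤ gradDist P F w w' + gradDist P F w' w'' := by
  have := lpNorm_sub_le_lpNorm_sub_add_lpNorm_sub (hv.memLp_gradient w'') (hv.memLp_gradient w')
    (h := fun ξ => gradient (F ξ) w) (by norm_num)
  rw [add_comm]
  exact this

lemma lpNorm_gradient_le (hv : HasUnbiasedBoundedVariance P F Γ Λ)
    (w w' : EuclideanSpace ℝ (Fin d)) :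
    lpNorm (fun ξ => gradient (F ξ) w') 2 P ≤
      lpNorm (fun ξ => gradient (F ξ) w) 2 P + gradDist P F w w' :=
  lpNorm_le_lpNorm_add_lpNorm_sub' (hv.memLp_gradient w) (by norm_num)

lemma gradDist_le_mul_sqrt (h : IsExpectedSymSmooth P F α L₀ L₁)
    (hv : HasUnbiasedBoundedVariance P F Γ Λ) (w w' : EuclideanSpace ℝ (Fin d)) :
    gradDist P F w w' ≤ ‖w' - w‖ * √(∫ ξ, (L₀ + L₁ * segMax F α ξ w w') ^ 2 ∂P) := by
  refine abs_le_of_sq_le_sq' ?_ (by positivity) |>.2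
  rw [mul_pow, Real.sq_sqrt (integral_nonneg fun _ => by positivity), gradDist,
    ← integral_norm_sq_eq_lpNorm_sq (X := fun ξ => gradient (F ξ) w' - gradient (F ξ) w)
      ((hv.memLp_gradient w').sub (hv.memLp_gradient w))]
  exact h.smooth w w'

/-- The maximum over the whole segment serves as a common Lipschitz factor for all subsegments. This
crude bound only supplies the continuity that the comparison theorem asks for. -/
lemma continuousOn_gradDist_segPoint (h : IsExpectedSymSmooth P F α L₀ L₁)
    (hv : HasUnbiasedBoundedVariance P F Γ Λ) (hα : 0 < α) (hL₀ : 0 < L₀) (hL₁ : 0 < L₁)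
    (w w' : EuclideanSpace ℝ (Fin d)) :
    ContinuousOn (fun θ => gradDist P F w (segPoint w w' θ)) (Set.Icc 0 1) := by
  set C : ℝ := ‖w' - w‖ * √(∫ ξ, (L₀ + L₁ * segMax F α ξ w w') ^ 2 ∂P) with hC
  have hC0 : 0 ≤ C := by positivity
  have key : ∀ x ∈ Set.Icc (0 : ℝ) 1, ∀ z ∈ Set.Icc (0 : ℝ) 1,
      gradDist P F (segPoint w w' x) (segPoint w w' z) ≤ C * |z - x| := by
    intro x hx z hz
    refine (gradDist_le_mul_sqrt h hv _ _).trans ?_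
    rw [segPoint_sub_segPoint, norm_smul, Real.norm_eq_abs, mul_assoc, mul_comm _ |z - x|, hC]
    have : ∫ ξ, (L₀ + L₁ * segMax F α ξ (segPoint w w' x) (segPoint w w' z)) ^ 2 ∂P ≤
        ∫ ξ, (L₀ + L₁ * segMax F α ξ w w') ^ 2 ∂P := by
      refine integral_mono (h.integrable_sq_segMax _ _) (h.integrable_sq_segMax _ _) fun ξ => ?_
      have h1 := h.segMax_segPoint_le hα ξ w w' hx hz
      have h2 := segMax_nonneg (F := F) (α := α) ξ (segPoint w w' x)
        (segPoint w w' z)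
      dsimp only
      gcongr
    gcongr
  have : LipschitzOnWith C.toNNReal (fun θ => gradDist P F w (segPoint w w' θ)) (Set.Icc 0 1) := by
    refine LipschitzOnWith.of_dist_le_mul fun x hx z hz => ?_
    rw [Real.dist_eq, Real.dist_eq, Real.coe_toNNReal _ hC0, abs_sub_comm x z]
    have h1 := key x hx z hz
    have h2 := gradDist_triangle hv w (segPoint w w' x) (segPoint w w' z)
    have h3 := gradDist_triangle hv w (segPoint w w' z) (segPoint w w' x)
    rw [gradDist_comm (segPoint w w' z)] at h3
    rw [abs_le]
    constructor <;> linarith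
  exact this.continuousOn

/-- A Grönwall type estimate: the sample gradients are `M`-Lipschitz in `L²` on a ball of radius
`γ` as soon as `M` dominates the smoothness factor that it implies on that ball. -/
lemma gradDist_le_of_fixed_bound (h : IsExpectedSymSmooth P F α L₀ L₁)
    (hv : HasUnbiasedBoundedVariance P F Γ Λ) (hα : 0 < α) (hα1 : α ≤ 1)
    (hL₀ : 0 < L₀) (hL₁ : 0 < L₁) {w w' : EuclideanSpace ℝ (Fin d)} {M γ : ℝ} (hM0 : 0 ≤ M)
    (hw : ‖w' - w‖ ≤ γ)
    (hM : L₀ + L₁ * (lpNorm (fun ξ => gradient (F ξ) w) 2 P + M * γ) ^ α < M) :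
    gradDist P F w w' ≤ M * ‖w' - w‖ := by
  rcases eq_or_ne w' w with rfl | hne
  · simp [gradDist_self]
  set r := ‖w' - w‖ with hr
  have hr0 : 0 < r := norm_pos_iff.2 (sub_ne_zero.2 hne)
  set m := lpNorm (fun ξ => gradient (F ξ) w) 2 P with hm
  have hm0 : 0 ≤ m := lpNorm_nonneg
  set u : ℝ → ℝ := fun θ => gradDist P F w (segPoint w w' θ) with hu
  have hu0 : ∀ θ, 0 ≤ u θ := fun θ => gradDist_nonneg _ _
  -- The line M r x is a fence for u. Wherever u touches it, u ≤ M γ, and the strict inequality `hM`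
  -- makes the right slope of u smaller than M r, so u cannot cross.
  have := image_le_of_liminf_slope_right_lt_deriv_boundary
    (f := u) (f' := fun x => r * (L₀ + L₁ * (m + u x) ^ α)) (a := 0) (b := 1)
    (continuousOn_gradDist_segPoint h hv hα hL₀ hL₁ w w') ?_
    (B := fun x => M * r * x) (B' := fun _ => M * r) (by simp [hu, gradDist_self])
    (fun x => by simpa using (hasDerivAt_id x).const_mul (M * r)) ?_
    (x := 1) (by simp)
  · simpa [hu] using this
  · intro x hx R hR
    have ht : Tendsto (fun z => r * √(∫ ξ, (L₀ + L₁ * segMax F α ξ (segPoint w w' x)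
        (segPoint w w' z)) ^ 2 ∂P)) (𝓝[>] x)
        (𝓝 (r * √(∫ ξ, (L₀ + L₁ * ‖gradient (F ξ) (segPoint w w' x)‖ ^ α) ^ 2 ∂P))) :=
      ((h.tendsto_integral_segMax hα hL₀ hL₁ w w' hx).sqrt).const_mul r
    have hlim : r * √(∫ ξ, (L₀ + L₁ * ‖gradient (F ξ) (segPoint w w' x)‖ ^ α) ^ 2 ∂P) < R := by
      refine lt_of_le_of_lt ?_ hR
      have h1 : lpNorm (fun ξ => gradient (F ξ) (segPoint w w' x)) 2 P ≤ m + u x :=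
        lpNorm_gradient_le hv _ _
      have h2 := integral_add_mul_rpow_sq_le (hv.memLp_gradient (segPoint w w' x)) hL₀.le hL₁.le
        hα.le hα1
      have h3 : √(∫ ξ, (L₀ + L₁ * ‖gradient (F ξ) (segPoint w w' x)‖ ^ α) ^ 2 ∂P) ≤
          L₀ + L₁ * lpNorm (fun ξ => gradient (F ξ) (segPoint w w' x)) 2 P ^ α := by
        refine Real.sqrt_le_iff.2 ⟨?_, h2⟩
        have := Real.rpow_nonneg
          (lpNorm_nonneg (f := fun ξ => gradient (F ξ) (segPoint w w' x)) (p := 2) (μ := P)) α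
        positivity
      have h4 : lpNorm (fun ξ => gradient (F ξ) (segPoint w w' x)) 2 P ^ α ≤ (m + u x) ^ α :=
        Real.rpow_le_rpow lpNorm_nonneg h1 hα.le
      have : L₁ * lpNorm (fun ξ => gradient (F ξ) (segPoint w w' x)) 2 P ^ α ≤
        L₁ * (m + u x) ^ α := mul_le_mul_of_nonneg_left h4 hL₁.le
      exact mul_le_mul_of_nonneg_left (by linarith) hr0.le
    -- By the triangle inequality the increment of u from x to z is at most the L² distance between
    -- the gradients at these two points, which the smoothness hypothesis on that subsegment
    -- controls.
    refine Eventually.frequently ?_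
    filter_upwards [ht.eventually (gt_mem_nhds hlim), self_mem_nhdsWithin] with z hz hxz
    refine lt_of_le_of_lt ?_ hz
    have hxz' : 0 < z - x := sub_pos.2 hxz
    rw [slope_def_field, div_le_iff₀ hxz']
    have h1 := gradDist_triangle hv w (segPoint w w' x) (segPoint w w' z)
    have h2 := gradDist_le_mul_sqrt h hv (segPoint w w' x) (segPoint w w' z)
    rw [segPoint_sub_segPoint, norm_smul, Real.norm_eq_abs, abs_of_pos hxz', ← hr] at h2
    simp only [hu]
    linarith
  · intro x hx hux
    rw [mul_comm M r]
    refine mul_lt_mul_of_pos_left (lt_of_le_of_lt ?_ hM) hr0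
    have : u x ≤ M * γ := by
      rw [hux, mul_assoc]
      refine mul_le_mul_of_nonneg_left ?_ hM0
      nlinarith [hx.1, hx.2]
    have h4 : (m + u x) ^ α ≤ (m + M * γ) ^ α :=
      Real.rpow_le_rpow (add_nonneg hm0 (hu0 x)) (by linarith) hα.le
    have := mul_le_mul_of_nonneg_left h4 hL₁.le
    linarith

end Gronwall

/-! ### Mean and variance of square integrable vectors. -/

section Moments

variable {S : Type*} [MeasurableSpace S] {P : Measure S} [IsProbabilityMeasure P]

lemma norm_integral_le_lpNorm_two {E : Type*} [NormedAddCommGroup E] [NormedSpace ℝ E]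
    {X : S → E} (hX : MemLp X 2 P) : ‖∫ s, X s ∂P‖ ≤ lpNorm X 2 P := by
  refine (norm_integral_le_integral_norm _).trans ?_
  have := integral_rpow_le_rpow_integral (integrable_norm_sq hX) (fun s => by positivity)
    (p := 1 / 2) (by norm_num) (by norm_num)
  simp only [integral_norm_sq_eq_lpNorm_sq hX, ← Real.sqrt_eq_rpow, Real.sqrt_sq (norm_nonneg _),
    Real.sqrt_sq (lpNorm_nonneg (f := X) (p := 2) (μ := P))] at this
  exact this

lemma integral_norm_sub_sq {E : Type*} [NormedAddCommGroup E] [InnerProductSpace ℝ E]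
    [CompleteSpace E] {X : S → E} (hX : MemLp X 2 P) :
    ∫ s, ‖X s - ∫ s, X s ∂P‖ ^ 2 ∂P = ∫ s, ‖X s‖ ^ 2 ∂P - ‖∫ s, X s ∂P‖ ^ 2 := by
  set c := ∫ s, X s ∂P with hc
  have hi : Integrable X P := hX.integrable (by norm_num)
  have h1 : ∀ s, ‖X s - c‖ ^ 2 = ‖X s‖ ^ 2 - 2 * inner ℝ c (X s) + ‖c‖ ^ 2 := fun s => by
    rw [norm_sub_sq_real, real_inner_comm]
  simp_rw [h1]
  have i1 : Integrable (fun s => 2 * inner ℝ c (X s)) P := (hi.const_inner c).const_mul 2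
  have i2 : Integrable (fun s => ‖X s‖ ^ 2 - 2 * inner ℝ c (X s)) P :=
    (integrable_norm_sq hX).sub i1
  rw [integral_add i2 (integrable_const _), integral_sub (integrable_norm_sq hX) i1,
    integral_const_mul, integral_inner hi, ← hc, real_inner_self_eq_norm_sq]
  simp
  ring

end Moments

/-! ### Linearity of the stepsize in the accuracy. -/

section Stepsize

variable {α L₀ L₁ Γ Λ ε : ℝ}

/-- The stepsize is `ε` times this factor. -/
def stepsizeFactor (α L₀ L₁ Γ Λ : ℝ) : ℝ := spiderStepsize α L₀ L₁ Γ Λ 1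

lemma spiderStepsize_eq : spiderStepsize α L₀ L₁ Γ Λ ε = stepsizeFactor α L₀ L₁ Γ Λ * ε := by
  unfold stepsizeFactor spiderStepsize
  split_ifs <;> ring

lemma stepsizeFactor_pos (hL₀ : 0 < L₀) (hL₁ : 0 < L₁) (hΓ : 0 < Γ) (hΛ : 0 < Λ) :
    0 < stepsizeFactor α L₀ L₁ Γ Λ := by
  unfold stepsizeFactor spiderStepsize
  split_ifs <;> positivity

lemma spiderStepsize_pos (hL₀ : 0 < L₀) (hL₁ : 0 < L₁) (hΓ : 0 < Γ) (hΛ : 0 < Λ) (hε : 0 < ε) :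
    0 < spiderStepsize α L₀ L₁ Γ Λ ε := by
  rw [spiderStepsize_eq]
  exact mul_pos (stepsizeFactor_pos hL₀ hL₁ hΓ hΛ) hε

end Stepsize

/-! ### Lipschitz constants on balls of the stepsize radius. -/

section Smooth

variable {d : ℕ} {S : Type*} [MeasurableSpace S] {P : Measure S} [IsProbabilityMeasure P]
  {F : S → EuclideanSpace ℝ (Fin d) → ℝ} {α L₀ L₁ Γ Λ ε : ℝ}

/-- The second moment is the variance plus the squared norm of the mean, and the mean is the
population gradient. -/
lemma lpNorm_gradient_sq_le (hv : HasUnbiasedBoundedVariance P F Γ Λ)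
    (w : EuclideanSpace ℝ (Fin d)) :
    lpNorm (fun ξ => gradient (F ξ) w) 2 P ^ 2 ≤
      (Γ ^ 2 + 1) * ‖gradient (popLoss P F) w‖ ^ 2 + Λ ^ 2 := by
  have h := integral_norm_sub_sq (hv.memLp_gradient w)
  have h2 := hv.variance_le w
  simp only [hv.unbiased w] at h
  rw [h, integral_norm_sq_eq_lpNorm_sq (hv.memLp_gradient w)] at h2
  linarith

lemma exists_fixed_bound_of_eq_one (hL₀ : 0 < L₀) (hL₁ : 0 < L₁) (hΓ : 0 < Γ) (hΛ : 0 < Λ)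
    (hε : 0 < ε) (hε1 : ε < 1) {g m : ℝ} (hg : 0 ≤ g) (hm : 0 ≤ m)
    (hmg : m ^ 2 ≤ (Γ ^ 2 + 1) * g ^ 2 + Λ ^ 2) :
    ∃ M, 0 ≤ M ∧ L₀ + L₁ * (m + M * spiderStepsize 1 L₀ L₁ Γ Λ ε) ^ (1 : ℝ) < M ∧
      spiderStepsize 1 L₀ L₁ Γ Λ ε * M ≤ ε / 4 * (1 + g) := by
  set s := √(Γ ^ 2 + 1) with hs
  set t := √(L₀ ^ 2 + 2 * L₁ ^ 2 * Λ ^ 2) with ht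
  have hs2 : s ^ 2 = Γ ^ 2 + 1 := Real.sq_sqrt (by positivity)
  have ht2 : t ^ 2 = L₀ ^ 2 + 2 * L₁ ^ 2 * Λ ^ 2 := Real.sq_sqrt (by positivity)
  have hs1 : 1 ≤ s := Real.one_le_sqrt.2 (by nlinarith [sq_nonneg Γ])
  have ht0 : 0 < t := Real.sqrt_pos.2 (by positivity)
  have hms : m ≤ s * g + Λ := by
    refine abs_le_of_sq_le_sq' ?_ (by positivity) |>.2
    have : 0 ≤ s * g * Λ := by positivity
    nlinarith
  have hD : 0 < 5 * L₁ * s + 8 * t := by positivity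
  have hγ : spiderStepsize 1 L₀ L₁ Γ Λ ε = ε / (5 * L₁ * s + 8 * t) := by
    simp [spiderStepsize, hs, ht]
  rw [hγ]
  set γ := ε / (5 * L₁ * s + 8 * t) with hγd
  have hγ0 : 0 < γ := by positivity
  have hγD : γ * (5 * L₁ * s + 8 * t) = ε := div_mul_cancel₀ _ hD.ne'
  have hγL : γ * (5 * L₁) < 1 := by
    have h1 : L₁ ≤ L₁ * s := by nlinarith
    have h2 : 0 < γ * t := by positivity
    nlinarith
  -- Squared: 25 (x + y)² ≤ 50 (x² + y²) ≤ 64 (x² + 2y²), with x = L₀ and y = L₁ Λ.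
  have htΛ : 5 * (L₀ + L₁ * Λ) ≤ 8 * t := by
    refine abs_le_of_sq_le_sq' ?_ (by positivity) |>.2
    nlinarith [sq_nonneg (L₀ - L₁ * Λ), sq_nonneg L₀, sq_nonneg (L₁ * Λ)]
  have hLm : 0 < L₀ + L₁ * m := by positivity
  -- With this M, L₀ + L₁ m is 4M/5, while 5 L₁ γ < 1 makes L₁ M γ smaller than the remaining M/5.
  refine ⟨5 / 4 * (L₀ + L₁ * m), by positivity, ?_, ?_⟩
  · rw [Real.rpow_one]
    nlinarith
  · have h1 : L₁ * m ≤ L₁ * (s * g + Λ) := by gcongr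
    have h2 : γ * (5 / 4 * (L₀ + L₁ * m)) ≤ γ * (5 / 4 * (L₀ + L₁ * (s * g + Λ))) := by gcongr
    have h3 : γ * (5 * (L₀ + L₁ * Λ)) ≤ γ * (8 * t) := by gcongr
    have h4 : 0 ≤ γ * t * g := by positivity
    have h5 : 0 ≤ γ * (L₁ * s) := by positivity
    rw [← hγD]
    nlinarith

lemma exists_fixed_bound_of_lt_one (hα : 0 < α) (hα1 : α < 1)
    (hL₀ : 0 < L₀) (hL₁ : 0 < L₁) (hΓ : 0 < Γ) (hΛ : 0 < Λ)
    (hε : 0 < ε) (hε1 : ε < 1) {g m : ℝ} (hg : 0 ≤ g) (hm : 0 ≤ m)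
    (hmg : m ^ 2 ≤ (Γ ^ 2 + 1) * g ^ 2 + Λ ^ 2) :
    ∃ M, 0 ≤ M ∧ L₀ + L₁ * (m + M * spiderStepsize α L₀ L₁ Γ Λ ε) ^ α < M ∧
      spiderStepsize α L₀ L₁ Γ Λ ε * M ≤ ε / 4 * (1 + g) := by
  have h1α : 0 < 1 - α := by linarith
  set c : ℝ := 2 ^ ((2 - α) / (1 - α)) with hc
  have hc4 : 4 ≤ c := by
    have : (2 : ℝ) ^ (2 : ℝ) ≤ c := by
      refine Real.rpow_le_rpow_of_exponent_le (by norm_num) ?_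
      rw [le_div_iff₀ h1α]
      linarith
    norm_num at this
    exact this
  set K : ℝ := (5 * L₁) ^ (1 / (1 - α)) with hK
  have hK0 : 0 < K := by positivity
  set D := 2 * (c * L₀) + 4 * K + 2 * (c * L₁) * (Λ ^ α + Γ ^ α + 1) + 1 with hD
  have hΛα : 0 < Λ ^ α := by positivity
  have hΓα : 0 < Γ ^ α := by positivity
  have hγ : spiderStepsize α L₀ L₁ Γ Λ ε = ε / D := by
    simp [spiderStepsize, hα1.ne, hc, hK, hD]
  have hD1 : 1 ≤ D := by
    have : 0 ≤ 2 * (c * L₀) + 4 * K + 2 * (c * L₁) * (Λ ^ α + Γ ^ α + 1) := by positivity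
    linarith
  rw [hγ]
  set γ := ε / D with hγd
  have hγ0 : 0 < γ := by positivity
  have hγD : γ * D = ε := div_mul_cancel₀ _ (by positivity)
  have hγ1 : γ ≤ 1 := by nlinarith
  have hms : m ≤ g + Γ * g + Λ := by
    refine abs_le_of_sq_le_sq' ?_ (by positivity) |>.2
    have : 0 ≤ Γ * g * Λ := by positivity
    have : 0 ≤ Γ * g * g := by positivity
    have : 0 ≤ g * Λ := by positivity
    nlinarith
  have hgα : g ^ α ≤ 1 + g := by
    rcases le_total g 1 with h | h
    · linarith [Real.rpow_le_one hg h hα.le]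
    · have := Real.rpow_le_rpow_of_exponent_le h hα1.le
      rw [Real.rpow_one] at this
      linarith
  have hgα0 : 0 ≤ g ^ α := by positivity
  have hmα : m ^ α ≤ (1 + Γ ^ α) * g ^ α + Λ ^ α := by
    calc m ^ α ≤ (g + Γ * g + Λ) ^ α := Real.rpow_le_rpow hm hms hα.le
      _ ≤ (g + Γ * g) ^ α + Λ ^ α :=
        Real.rpow_add_le_add_rpow (by positivity) hΛ.le hα.le hα1.le
      _ ≤ (g ^ α + (Γ * g) ^ α) + Λ ^ α := by
        gcongr
        exact Real.rpow_add_le_add_rpow hg (by positivity) hα.le hα1.le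
      _ = _ := by rw [Real.mul_rpow hΓ.le hg]; ring
  have hmα0 : 0 ≤ m ^ α := by positivity
  -- K solves 5 L₁ K^α = K. Since M ≥ K and α < 1, also 5 L₁ M^α ≤ M. By subadditivity of the power
  -- and γ ≤ 1, the left side of the fixed-point inequality is at most 4(M - K)/5 + M/5 < M.
  set M := 5 / 4 * (L₀ + L₁ * m ^ α) + K with hM
  have hM0 : 0 < M := by positivity
  have hMα : 5 * L₁ * M ^ α ≤ M := by
    have hKp : K ^ (1 - α) = 5 * L₁ := by
      rw [hK, ← Real.rpow_mul (by positivity), one_div_mul_cancel h1α.ne', Real.rpow_one]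
    have hKM : K ≤ M := by
      have : 0 ≤ 5 / 4 * (L₀ + L₁ * m ^ α) := by positivity
      linarith
    calc 5 * L₁ * M ^ α = K ^ (1 - α) * M ^ α := by rw [hKp]
      _ ≤ M ^ (1 - α) * M ^ α := by gcongr
      _ = M := by rw [← Real.rpow_add hM0]; simp
  refine ⟨M, hM0.le, ?_, ?_⟩
  · have h1 : (m + M * γ) ^ α ≤ m ^ α + M ^ α :=
      (Real.rpow_add_le_add_rpow hm (by positivity) hα.le hα1.le).trans (by
        gcongr
        nlinarith)
    have h2 := mul_le_mul_of_nonneg_left h1 hL₁.le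
    nlinarith
  · have h1 : m ^ α ≤ (Λ ^ α + Γ ^ α + 1) * (1 + g) := by
      refine hmα.trans ?_
      have : (1 + Γ ^ α) * g ^ α ≤ (1 + Γ ^ α) * (1 + g) := by gcongr
      have : 0 ≤ Λ ^ α * g := by positivity
      nlinarith
    set A := Λ ^ α + Γ ^ α + 1 with hA
    have hA0 : 0 < A := by positivity
    have h2 : M * 4 ≤ D * (1 + g) := by
      have e1 : L₁ * m ^ α ≤ L₁ * (A * (1 + g)) := by gcongr
      have e2 : 4 * L₀ * (1 + g) ≤ c * L₀ * (1 + g) := by gcongr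
      have e3 : 4 * L₁ * (A * (1 + g)) ≤ c * L₁ * (A * (1 + g)) := by gcongr
      have e4 : 0 ≤ L₀ * g := by positivity
      have e5 : 0 ≤ K * g := by positivity
      have e6 : 0 ≤ L₁ * (A * (1 + g)) := by positivity
      have e7 : D * (1 + g) = 2 * (c * L₀ * (1 + g)) + 4 * K + 4 * (K * g) +
          2 * (c * L₁ * (A * (1 + g))) + (1 + g) := by
        rw [hD]; ring
      rw [e7, hM]
      linarith
    have h3 := mul_le_mul_of_nonneg_left h2 hγ0.le
    rw [← hγD]
    linarith

/-- On balls of the radius of the stepsize, the sample gradients are Lipschitz in `L²` with a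
factor affine in the norm of the gradient of the population loss. -/
lemma gradDist_le_of_le_stepsize (h : IsExpectedSymSmooth P F α L₀ L₁)
    (hv : HasUnbiasedBoundedVariance P F Γ Λ) (hα : 0 < α) (hα1 : α ≤ 1)
    (hL₀ : 0 < L₀) (hL₁ : 0 < L₁) (hΓ : 0 < Γ) (hΛ : 0 < Λ) (hε : 0 < ε) (hε1 : ε < 1)
    {w w' : EuclideanSpace ℝ (Fin d)} (hw : ‖w' - w‖ ≤ spiderStepsize α L₀ L₁ Γ Λ ε) :
    gradDist P F w w' ≤ ε / (4 * spiderStepsize α L₀ L₁ Γ Λ ε) *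
      (1 + ‖gradient (popLoss P F) w‖) * ‖w' - w‖ := by
  have hγ := spiderStepsize_pos (α := α) hL₀ hL₁ hΓ hΛ hε
  obtain ⟨M, hM0, hM, hMγ⟩ : ∃ M, 0 ≤ M ∧
      L₀ + L₁ * (lpNorm (fun ξ => gradient (F ξ) w) 2 P +
        M * spiderStepsize α L₀ L₁ Γ Λ ε) ^ α < M ∧
      spiderStepsize α L₀ L₁ Γ Λ ε * M ≤ ε / 4 * (1 + ‖gradient (popLoss P F) w‖) := by
    have hm := lpNorm_gradient_sq_le hv w
    rcases hα1.lt_or_eq with hlt | rfl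
    · exact exists_fixed_bound_of_lt_one hα hlt hL₀ hL₁ hΓ hΛ hε hε1 (norm_nonneg _)
        lpNorm_nonneg hm
    · exact exists_fixed_bound_of_eq_one hL₀ hL₁ hΓ hΛ hε hε1 (norm_nonneg _) lpNorm_nonneg hm
  refine (gradDist_le_of_fixed_bound h hv hα hα1 hL₀ hL₁ hM0 hw hM).trans ?_
  refine mul_le_mul_of_nonneg_right ?_ (norm_nonneg _)
  rw [div_mul_eq_mul_div, le_div_iff₀ (by positivity)]
  linarith

lemma norm_gradient_popLoss_sub_le (hv : HasUnbiasedBoundedVariance P F Γ Λ)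
    (w w' : EuclideanSpace ℝ (Fin d)) :
    ‖gradient (popLoss P F) w' - gradient (popLoss P F) w‖ ≤ gradDist P F w w' := by
  rw [← hv.unbiased, ← hv.unbiased,
    ← integral_sub (hv.integrable_gradient w') (hv.integrable_gradient w)]
  exact norm_integral_le_lpNorm_two ((hv.memLp_gradient w').sub (hv.memLp_gradient w))

end Smooth

/-! ### Descent along a normalized inexact gradient. -/

section Descent

variable {d : ℕ} {f : EuclideanSpace ℝ (Fin d) → ℝ} {w : EuclideanSpace ℝ (Fin d)} {γ K : ℝ}

/-- The descent lemma for a function with Lipschitz gradient at `w`. -/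
lemma le_add_inner_of_gradient_lipschitz (hf : Differentiable ℝ f) {c : ℝ}
    {w' : EuclideanSpace ℝ (Fin d)}
    (hc : ∀ y, ‖y - w‖ ≤ ‖w' - w‖ → ‖gradient f y - gradient f w‖ ≤ c * ‖y - w‖) :
    f w' ≤ f w + inner ℝ (gradient f w) (w' - w) + c / 2 * ‖w' - w‖ ^ 2 := by
  set p := w' - w with hp
  -- Up to the constant f(w), φ is f on the segment minus its quadratic model. Comparing gradients
  -- with the one at w alone already makes φ decreasing.
  set φ : ℝ → ℝ := fun θ => f (w + θ • p) - θ * inner ℝ (gradient f w) p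
    - c / 2 * ‖p‖ ^ 2 * θ ^ 2 with hφ
  have hd : ∀ θ, HasDerivAt φ (inner ℝ (gradient f (w + θ • p)) p - inner ℝ (gradient f w) p
      - c * ‖p‖ ^ 2 * θ) θ := by
    intro θ
    have h1 : HasDerivAt (fun θ : ℝ => w + θ • p) p θ := by
      simpa using ((hasDerivAt_id θ).smul_const p).const_add w
    have h2 := (hf (w + θ • p)).hasGradientAt.hasFDerivAt.comp_hasDerivAt θ h1
    have h3 := (hasDerivAt_id θ).mul_const (inner ℝ (gradient f w) p)
    have h4 := ((hasDerivAt_id θ).pow 2).const_mul (c / 2 * ‖p‖ ^ 2)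
    have h5 := (h2.sub h3).sub h4
    refine HasDerivAt.congr_deriv (f := φ) h5 ?_
    rw [InnerProductSpace.toDual_apply_apply]
    norm_num
    ring
  have hanti : AntitoneOn φ (Set.Icc 0 1) := by
    refine antitoneOn_of_deriv_nonpos (convex_Icc 0 1)
      (fun θ _ => (hd θ).continuousAt.continuousWithinAt)
      (fun θ _ => (hd θ).differentiableAt.differentiableWithinAt) fun θ hθ => ?_
    rw [interior_Icc] at hθ
    rw [(hd θ).deriv, ← inner_sub_left]
    have h1 := hc (w + θ • p) (by
      rw [add_sub_cancel_left, norm_smul, Real.norm_of_nonneg hθ.1.le]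
      nlinarith [norm_nonneg p, hθ.2])
    rw [add_sub_cancel_left, norm_smul, Real.norm_of_nonneg hθ.1.le] at h1
    have h2 := real_inner_le_norm (gradient f (w + θ • p) - gradient f w) p
    have h3 := mul_le_mul_of_nonneg_right h1 (norm_nonneg p)
    nlinarith
  have := hanti (by simp : (0 : ℝ) ∈ Set.Icc (0 : ℝ) 1) (by simp : (1 : ℝ) ∈ Set.Icc (0 : ℝ) 1)
    zero_le_one
  simp only [hφ, one_smul, zero_smul, add_zero, hp, add_sub_cancel] at this
  linarith

lemma norm_smul_inv_norm_smul_le {v : EuclideanSpace ℝ (Fin d)} (hγ : 0 ≤ γ) :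
    ‖γ • (‖v‖⁻¹ • v)‖ ≤ γ := by
  rw [norm_smul, norm_smul, Real.norm_of_nonneg hγ, norm_inv, norm_norm]
  exact mul_le_of_le_one_right hγ inv_mul_le_one

/-- One normalized step along the inexact gradient `v`. -/
lemma normalized_step_descent (hf : Differentiable ℝ f) (hγ : 0 ≤ γ) (hK : 0 ≤ K)
    (hc : ∀ y, ‖y - w‖ ≤ γ → ‖gradient f y - gradient f w‖ ≤
      K * (1 + ‖gradient f w‖) * ‖y - w‖) (v : EuclideanSpace ℝ (Fin d)) :
    f (w - γ • (‖v‖⁻¹ • v)) ≤ f w - γ * ‖gradient f w‖ + 2 * γ * ‖v - gradient f w‖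
      + K / 2 * (1 + ‖gradient f w‖) * γ ^ 2 := by
  set g := gradient f w with hg
  have hr := norm_smul_inv_norm_smul_le (v := v) hγ
  have h1 := le_add_inner_of_gradient_lipschitz hf (w := w) (w' := w - γ • (‖v‖⁻¹ • v))
    (c := K * (1 + ‖g‖)) (fun y hy => hc y (hy.trans (by simpa using hr)))
  have e : w - γ • (‖v‖⁻¹ • v) - w = -(γ • (‖v‖⁻¹ • v)) := by abel
  rw [e, norm_neg, inner_neg_right, inner_smul_right, inner_smul_right] at h1
  have h2 : K * (1 + ‖g‖) / 2 * ‖γ • (‖v‖⁻¹ • v)‖ ^ 2 ≤ K * (1 + ‖g‖) / 2 * γ ^ 2 := by gcongr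
  -- The component of g along v is at least ‖v‖ - ‖v - g‖ ≥ ‖g‖ - 2‖v - g‖. For v = 0 the right side
  -- is 0 and the left side is -‖g‖.
  have h3 : ‖g‖ - 2 * ‖v - g‖ ≤ ‖v‖⁻¹ * inner ℝ g v := by
    have h4 : ‖g‖ ≤ ‖v - g‖ + ‖v‖ := by
      have := norm_sub_le v (v - g)
      rw [sub_sub_cancel] at this
      linarith
    rcases eq_or_ne v 0 with rfl | hv
    · simp only [zero_sub, norm_neg, norm_zero, inv_zero, zero_mul]
      linarith [norm_nonneg g]
    · have hv0 : 0 < ‖v‖ := norm_pos_iff.2 hv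
      have h5 : inner ℝ g v = ‖v‖ ^ 2 - inner ℝ (v - g) v := by
        rw [inner_sub_left, real_inner_self_eq_norm_sq]; ring
      have h6 := real_inner_le_norm (v - g) v
      have h7 : ‖v‖⁻¹ * inner ℝ g v ≥ ‖v‖ - ‖v - g‖ := by
        rw [ge_iff_le, inv_mul_eq_div, le_div_iff₀ hv0]
        nlinarith
      linarith
  have h8 := mul_le_mul_of_nonneg_left h3 hγ
  linarith

end Descent

/-! ### Joint measurability of the sample gradients. -/

section Measurability

open Filter Topology

variable {d : ℕ} {S : Type*} [MeasurableSpace S] {F : S → EuclideanSpace ℝ (Fin d) → ℝ}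

/-- Measurable in the sample and continuous in the point, F is jointly measurable. Each component of
the gradient is a limit of the difference quotients n (F(w + v/n) - F(w)), and an orthonormal basis
reassembles the vector. -/
lemma measurable_uncurry_gradient (hm : ∀ w, Measurable fun ξ => F ξ w)
    (hd : ∀ ξ, Differentiable ℝ (F ξ)) :
    Measurable fun p : S × EuclideanSpace ℝ (Fin d) => gradient (F p.1) p.2 := by
  have hF : Measurable fun p : S × EuclideanSpace ℝ (Fin d) => F p.1 p.2 :=
    (measurable_uncurry_of_continuous_of_measurable (u := fun w ξ => F ξ w)
      (fun ξ => (hd ξ).continuous) hm).comp measurable_swap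
  have hcoord : ∀ v : EuclideanSpace ℝ (Fin d),
      Measurable fun p : S × EuclideanSpace ℝ (Fin d) => inner ℝ v (gradient (F p.1) p.2) := by
    intro v
    refine measurable_of_tendsto_metrizable
      (f := fun (n : ℕ) (p : S × EuclideanSpace ℝ (Fin d)) =>
        (n : ℝ) • (F p.1 (p.2 + (n : ℝ)⁻¹ • v) - F p.1 p.2)) (fun n => ?_) ?_
    · have : Measurable fun p : S × EuclideanSpace ℝ (Fin d) =>
          ((p.1, p.2 + (n : ℝ)⁻¹ • v) : S × EuclideanSpace ℝ (Fin d)) := by fun_prop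
      exact ((hF.comp this).sub hF).const_smul (n : ℝ)
    · rw [tendsto_pi_nhds]
      intro p
      have h := (hd p.1 p.2).hasGradientAt.hasFDerivAt.lim v (c := fun n : ℕ => (n : ℝ))
        (l := atTop) (by simpa using tendsto_natCast_atTop_atTop)
      rwa [InnerProductSpace.toDual_apply_apply, real_inner_comm] at h
  have hsum : (fun p : S × EuclideanSpace ℝ (Fin d) => gradient (F p.1) p.2) =
      fun p => ∑ i, inner ℝ (EuclideanSpace.basisFun (Fin d) ℝ i) (gradient (F p.1) p.2) •
        EuclideanSpace.basisFun (Fin d) ℝ i := by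
    funext p
    exact ((EuclideanSpace.basisFun (Fin d) ℝ).sum_repr' _).symm
  rw [hsum]
  exact Finset.measurable_sum _ fun i _ => (hcoord _).smul_const _

lemma measurable_gradient {f : EuclideanSpace ℝ (Fin d) → ℝ} (hf : Differentiable ℝ f) :
    Measurable (gradient f) :=
  (measurable_uncurry_gradient (S := Unit) (F := fun _ => f) (fun _ => measurable_const)
    fun _ => hf).comp (measurable_const.prodMk measurable_id : Measurable fun w => ((), w))

end Measurability

/-! ### Independence and freezing of variables. -/

section Independence

variable {Ω : Type*} [MeasurableSpace Ω] {μ : Measure Ω}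

lemma ProbabilityTheory.iIndepFun.indepFun_of_disjoint {ι S : Type*} [MeasurableSpace S]
    {f : ι → Ω → S} (h : iIndepFun f μ) (hf : ∀ i, Measurable (f i)) {s t : Set ι}
    (hst : Disjoint s t) :
    IndepFun (fun ω (i : s) => f i ω) (fun ω (i : t) => f i ω) μ := by
  have hcomap : ∀ s : Set ι, MeasurableSpace.comap (fun ω (i : s) => f i ω) inferInstance ≤
      ⨆ i ∈ s, MeasurableSpace.comap (f i) inferInstance := by
    intro s
    rw [← measurable_iff_comap_le]
    refine @measurable_pi_lambda _ _ _ (_) _ _ fun i => ?_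
    exact measurable_iff_comap_le.2
      (le_iSup₂_of_le (f := fun i (_ : i ∈ s) => MeasurableSpace.comap (f i) inferInstance)
        i.1 i.2 le_rfl)
  rw [IndepFun_iff_Indep]
  exact indep_of_indep_of_le_left (indep_of_indep_of_le_right
    (indep_iSup_of_disjoint (fun i => (hf i).comap_le) h hst) (hcomap t)) (hcomap s)

variable [IsProbabilityMeasure μ]

/-- The joint law is a product, so Tonelli's theorem lets X be frozen while Y is integrated. This
plays the role of conditioning on the past, with no integrability to check. -/
lemma ProbabilityTheory.IndepFun.lintegral_eq {X' Y' : Type*} [MeasurableSpace X']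
    [MeasurableSpace Y'] {X : Ω → X'} {Y : Ω → Y'} (h : IndepFun X Y μ) (hX : Measurable X)
    (hY : Measurable Y) {Ψ : X' → Y' → ENNReal} (hΨ : Measurable (Function.uncurry Ψ)) :
    ∫⁻ ω, Ψ (X ω) (Y ω) ∂μ = ∫⁻ ω, ∫⁻ ω', Ψ (X ω) (Y ω') ∂μ ∂μ := by
  have h1 : ∫⁻ ω, Ψ (X ω) (Y ω) ∂μ =
      ∫⁻ p, Function.uncurry Ψ p ∂(μ.map fun ω => (X ω, Y ω)) := by
    rw [lintegral_map hΨ (hX.prodMk hY)]; rfl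
  have := Measure.isProbabilityMeasure_map (μ := μ) hY.aemeasurable
  rw [h1, (indepFun_iff_map_prod_eq_prod_map_map hX.aemeasurable hY.aemeasurable).1 h,
    lintegral_prod _ hΨ.aemeasurable, lintegral_map hΨ.lintegral_prod_right' hX]
  refine lintegral_congr fun ω => ?_
  exact lintegral_map (f := fun y => Function.uncurry Ψ (X ω, y))
    (hΨ.comp measurable_prodMk_left) hY

/-- The joint law is the triple product of the marginals, and reassociating it separates the pair
from C. -/
lemma ProbabilityTheory.IndepFun.prodMk_assoc {A' B' C' : Type*} [MeasurableSpace A']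
    [MeasurableSpace B'] [MeasurableSpace C'] {A : Ω → A'} {B : Ω → B'} {C : Ω → C'}
    (hA : Measurable A) (hB : Measurable B) (hC : Measurable C)
    (h : IndepFun A (fun ω => (B ω, C ω)) μ) (hBC : IndepFun B C μ) :
    IndepFun (fun ω => (A ω, B ω)) C μ := by
  have hAB : IndepFun A B μ := h.comp measurable_id measurable_fst
  have := Measure.isProbabilityMeasure_map (μ := μ) hA.aemeasurable
  have := Measure.isProbabilityMeasure_map (μ := μ) hB.aemeasurable
  have := Measure.isProbabilityMeasure_map (μ := μ) hC.aemeasurable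
  rw [indepFun_iff_map_prod_eq_prod_map_map (hA.prodMk hB).aemeasurable hC.aemeasurable,
    (indepFun_iff_map_prod_eq_prod_map_map hA.aemeasurable hB.aemeasurable).1 hAB]
  have h1 := (indepFun_iff_map_prod_eq_prod_map_map hA.aemeasurable
    (hB.prodMk hC).aemeasurable).1 h
  rw [(indepFun_iff_map_prod_eq_prod_map_map hB.aemeasurable hC.aemeasurable).1 hBC,
    ← Measure.prodAssoc_prod] at h1
  have h2 := congrArg (Measure.map MeasurableEquiv.prodAssoc.symm) h1
  rw [Measure.map_map (by fun_prop) (by fun_prop), Measure.map_map (by fun_prop) (by fun_prop)]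
    at h2
  have h3 : MeasurableEquiv.prodAssoc.symm ∘ MeasurableEquiv.prodAssoc =
    (id : (A' × B') × C' → (A' × B') × C') := rfl
  rw [h3, Measure.map_id] at h2
  exact h2

end Independence

/-! ### Moments of minibatch averages. -/

section Batch

variable {Ω S : Type*} [MeasurableSpace Ω] [MeasurableSpace S] {μ : Measure Ω}
  [IsProbabilityMeasure μ] {P : Measure S}
  {E : Type*} [NormedAddCommGroup E] [InnerProductSpace ℝ E] [CompleteSpace E]
  [MeasurableSpace E] [BorelSpace E] [SecondCountableTopology E]

/-- The second moment of a sum of i.i.d. centered random vectors. -/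
lemma integral_norm_sum_sq_of_iid {ξ : ℕ → Ω → S} (hξ : ∀ i, Measurable (ξ i))
    (hlaw : ∀ i, μ.map (ξ i) = P) (hind : iIndepFun ξ μ) {h : S → E} (hm : Measurable h)
    (h2 : MemLp h 2 P) (h0 : ∫ s, h s ∂P = 0) (n : ℕ) :
    ∫ ω, ‖∑ i ∈ Finset.range n, h (ξ i ω)‖ ^ 2 ∂μ = n * ∫ s, ‖h s‖ ^ 2 ∂P := by
  have hL : ∀ i, MemLp (fun ω => h (ξ i ω)) 2 μ := fun i => by
    have := h2; rw [← hlaw i] at this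
    exact this.comp_of_map (hξ i).aemeasurable
  have hsum : ∀ n, MemLp (fun ω => ∑ i ∈ Finset.range n, h (ξ i ω)) 2 μ := fun n =>
    memLp_finsetSum _ fun i _ => hL i
  have hint : ∀ i, ∫ ω, h (ξ i ω) ∂μ = 0 := fun i => by
    rw [← integral_map (hξ i).aemeasurable hm.aestronglyMeasurable, hlaw i, h0]
  have hsq : ∀ i, ∫ ω, ‖h (ξ i ω)‖ ^ 2 ∂μ = ∫ s, ‖h s‖ ^ 2 ∂P := fun i => by
    rw [← integral_map (f := fun s => ‖h s‖ ^ 2) (hξ i).aemeasurable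
      (by fun_prop), hlaw i]
  induction n with
  | zero => simp
  | succ n ih =>
    have hi : IndepFun (fun ω => ∑ i ∈ Finset.range n, h (ξ i ω)) (fun ω => h (ξ n ω)) μ := by
      have h1 : iIndepFun (fun i ω => h (ξ i ω)) μ := hind.comp (fun _ => h) fun _ => hm
      have := h1.indepFun_sum_range_succ (fun i => hm.comp (hξ i)) n
      convert this using 1
      ext ω; simp
    -- The cross term vanishes: the new summand is centered and independent of the earlier ones.
    have hB := hi.integral_bilin ((hsum n).integrable (by norm_num))
      ((hL n).integrable (by norm_num)) (innerSL ℝ)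
    rw [hint n, map_zero] at hB
    change ∫ ω, inner ℝ (∑ i ∈ Finset.range n, h (ξ i ω)) (h (ξ n ω)) ∂μ = 0 at hB
    simp_rw [Finset.sum_range_succ, norm_add_sq_real]
    have i1 : Integrable (fun ω => inner ℝ (∑ i ∈ Finset.range n, h (ξ i ω)) (h (ξ n ω))) μ := by
      refine Integrable.mono' ((integrable_norm_sq (hsum n)).add (integrable_norm_sq (hL n)))
        ((hsum n).aestronglyMeasurable.inner (hL n).aestronglyMeasurable)
        (.of_forall fun ω => ?_)
      refine (norm_inner_le_norm _ _).trans ?_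
      simp only [Pi.add_apply]
      nlinarith [sq_nonneg (‖∑ i ∈ Finset.range n, h (ξ i ω)‖ - ‖h (ξ n ω)‖),
        norm_nonneg (∑ i ∈ Finset.range n, h (ξ i ω)), norm_nonneg (h (ξ n ω))]
    have i2 : Integrable (fun ω => ‖∑ i ∈ Finset.range n, h (ξ i ω)‖ ^ 2 +
        2 * inner ℝ (∑ i ∈ Finset.range n, h (ξ i ω)) (h (ξ n ω))) μ :=
      (integrable_norm_sq (hsum n)).add (i1.const_mul 2)
    rw [integral_add i2 (integrable_norm_sq (hL n)),
      integral_add (integrable_norm_sq (hsum n)) (i1.const_mul 2), integral_const_mul, hB, ih,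
      hsq n]
    push_cast
    ring

/-- Jensen's inequality for a minibatch average of i.i.d. centered random vectors. -/
lemma lintegral_sqrt_norm_add_batch_le {ξ : ℕ → Ω → S} (hξ : ∀ i, Measurable (ξ i))
    (hlaw : ∀ i, μ.map (ξ i) = P) (hind : iIndepFun ξ μ) {h : S → E} (hm : Measurable h)
    (h2 : MemLp h 2 P) (h0 : ∫ s, h s ∂P = 0) {n : ℕ} (hn : 0 < n) (e : E) {c : ℝ} (hc : 0 ≤ c) :
    ∫⁻ ω, ENNReal.ofReal √(‖e + (n : ℝ)⁻¹ • ∑ i ∈ Finset.range n, h (ξ i ω)‖ ^ 2 + c) ∂μ ≤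
      ENNReal.ofReal √(‖e‖ ^ 2 + (∫ s, ‖h s‖ ^ 2 ∂P) / n + c) := by
  have hL : ∀ i, MemLp (fun ω => h (ξ i ω)) 2 μ := fun i => by
    have := h2; rw [← hlaw i] at this
    exact this.comp_of_map (hξ i).aemeasurable
  have hsum : MemLp (fun ω => (n : ℝ)⁻¹ • ∑ i ∈ Finset.range n, h (ξ i ω)) 2 μ :=
    (memLp_finsetSum _ fun i _ => hL i).const_smul _
  have hint : ∫ ω, (n : ℝ)⁻¹ • ∑ i ∈ Finset.range n, h (ξ i ω) ∂μ = 0 := by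
    rw [integral_smul, integral_finsetSum _ fun i _ => (hL i).integrable (by norm_num)]
    have : ∀ i, ∫ ω, h (ξ i ω) ∂μ = 0 := fun i => by
      rw [← integral_map (hξ i).aemeasurable hm.aestronglyMeasurable, hlaw i, h0]
    simp [this]
  have hsq : ∫ ω, ‖(n : ℝ)⁻¹ • ∑ i ∈ Finset.range n, h (ξ i ω)‖ ^ 2 ∂μ =
      (∫ s, ‖h s‖ ^ 2 ∂P) / n := by
    simp_rw [norm_smul, mul_pow]
    rw [integral_const_mul, integral_norm_sum_sq_of_iid hξ hlaw hind hm h2 h0]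
    have : (n : ℝ) ≠ 0 := by positivity
    simp
    field_simp
  set Z : Ω → E := fun ω => (n : ℝ)⁻¹ • ∑ i ∈ Finset.range n, h (ξ i ω) with hZ
  have i1 : Integrable (fun ω => inner ℝ e (Z ω)) μ :=
    (hsum.integrable (by norm_num)).const_inner e
  -- The deterministic e is the error inherited from the past. As Z is centered, the squares add
  -- exactly; Jensen's inequality for the square root follows.
  have hfull : ∫ ω, (‖e + Z ω‖ ^ 2 + c) ∂μ = ‖e‖ ^ 2 + (∫ s, ‖h s‖ ^ 2 ∂P) / n + c := by
    simp_rw [norm_add_sq_real]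
    have i2 : Integrable (fun ω => ‖e‖ ^ 2 + 2 * inner ℝ e (Z ω)) μ :=
      (integrable_const _).add (i1.const_mul 2)
    have i3 : Integrable (fun ω => ‖e‖ ^ 2 + 2 * inner ℝ e (Z ω) + ‖Z ω‖ ^ 2) μ :=
      i2.add (integrable_norm_sq hsum)
    rw [integral_add i3 (integrable_const _), integral_add i2 (integrable_norm_sq hsum),
      integral_add (integrable_const _) (i1.const_mul 2), integral_const_mul,
      integral_inner (hsum.integrable (by norm_num)), hint, hsq]
    simp
  have hI : Integrable (fun ω => ‖e + Z ω‖ ^ 2 + c) μ :=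
    (integrable_norm_sq ((memLp_const e).add hsum)).add (integrable_const c)
  have hnn : ∀ ω, 0 ≤ ‖e + Z ω‖ ^ 2 + c := fun ω => by positivity
  have hJ := integral_rpow_le_rpow_integral hI hnn (p := 1 / 2) (by norm_num) (by norm_num)
  have hJI := integrable_rpow_of_le_one hI hnn (p := 1 / 2) (by norm_num) (by norm_num)
  simp only [← Real.sqrt_eq_rpow, hfull] at hJ hJI
  rw [← ofReal_integral_eq_lintegral_ofReal hJI (.of_forall fun _ => Real.sqrt_nonneg _)]
  exact ENNReal.ofReal_le_ofReal hJ

end Batch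

/-! ### Recursion and measurability of the iteration. -/

section Spider

variable {d : ℕ} {S : Type*} {F : S → EuclideanSpace ℝ (Fin d) → ℝ} {γ : ℝ} {q B B' : ℕ}

lemma spider_succ_fst (w₀ : EuclideanSpace ℝ (Fin d)) (s : ℕ → ℕ → S) (t : ℕ) :
    (spider F γ q B B' w₀ s (t + 1)).1 = (spider F γ q B B' w₀ s t).1 -
      γ • (‖(spider F γ q B B' w₀ s t).2‖⁻¹ • (spider F γ q B B' w₀ s t).2) := rfl

lemma spider_snd_of_mod_eq_zero (w₀ : EuclideanSpace ℝ (Fin d)) (s : ℕ → ℕ → S) {t : ℕ}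
    (ht : t % q = 0) :
    (spider F γ q B B' w₀ s t).2 = batchGradient F (s t) B (spider F γ q B B' w₀ s t).1 := by
  cases t with
  | zero => simp [spider, batchSize]
  | succ t => simp [spider, batchSize, ht]

lemma spider_succ_snd (w₀ : EuclideanSpace ℝ (Fin d)) (s : ℕ → ℕ → S) {t : ℕ}
    (ht : (t + 1) % q ≠ 0) :
    (spider F γ q B B' w₀ s (t + 1)).2 = (spider F γ q B B' w₀ s t).2
      + batchGradient F (s (t + 1)) B' (spider F γ q B B' w₀ s (t + 1)).1
      - batchGradient F (s (t + 1)) B' (spider F γ q B B' w₀ s t).1 := by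
  simp [spider, batchSize, ht]

variable [MeasurableSpace S]

lemma measurable_batchGradient {Ω : Type*} [MeasurableSpace Ω]
    (hG : Measurable fun p : S × EuclideanSpace ℝ (Fin d) => gradient (F p.1) p.2)
    {s : Ω → ℕ → S} (hs : ∀ i, Measurable fun ω => s ω i) (n : ℕ)
    {w : Ω → EuclideanSpace ℝ (Fin d)} (hw : Measurable w) :
    Measurable fun ω => batchGradient F (s ω) n (w ω) :=
  (Finset.measurable_sum (Finset.range n) (f := fun i ω => gradient (F (s ω i)) (w ω))
    fun i _ => hG.comp ((hs i).prodMk hw)).const_smul (n : ℝ)⁻¹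

/-- Only the batches up to t need be measurable, so the σ-algebra on Ω may be the one generated by
the past; this is how adaptedness of the iterates is obtained. -/
lemma measurable_spider {Ω : Type*} [MeasurableSpace Ω]
    (hG : Measurable fun p : S × EuclideanSpace ℝ (Fin d) => gradient (F p.1) p.2)
    {W₀ : Ω → EuclideanSpace ℝ (Fin d)} (h0 : Measurable W₀) {ξ : ℕ → ℕ → Ω → S} (t : ℕ)
    (hξ : ∀ s ≤ t, ∀ i, Measurable (ξ s i)) :
    Measurable fun ω => spider F γ q B B' (W₀ ω) (fun t i => ξ t i ω) t := by
  induction t with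
  | zero => exact h0.prodMk (measurable_batchGradient hG (fun i => hξ 0 le_rfl i) _ h0)
  | succ t ih =>
    have ih := ih fun s hs => hξ s (hs.trans t.le_succ)
    have hw : Measurable fun ω => (spider F γ q B B' (W₀ ω) (fun t i => ξ t i ω) (t + 1)).1 := by
      simp only [spider_succ_fst]
      fun_prop
    refine Measurable.prodMk hw ?_
    have hY : ∀ i, Measurable fun ω => ξ (t + 1) i ω := fun i => hξ (t + 1) le_rfl i
    by_cases ht : (t + 1) % q = 0
    · simp only [ht, if_true]
      exact measurable_batchGradient hG hY _ hw
    · simp only [ht, if_false]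
      exact (ih.snd.add (measurable_batchGradient hG hY _ hw)).sub
        (measurable_batchGradient hG hY _ ih.fst)

lemma measurable_spider_fst {Ω : Type*} [MeasurableSpace Ω]
    (hG : Measurable fun p : S × EuclideanSpace ℝ (Fin d) => gradient (F p.1) p.2)
    {W₀ : Ω → EuclideanSpace ℝ (Fin d)} (h0 : Measurable W₀) {ξ : ℕ → ℕ → Ω → S} (t : ℕ)
    (hξ : ∀ s < t, ∀ i, Measurable (ξ s i)) :
    Measurable fun ω => (spider F γ q B B' (W₀ ω) (fun t i => ξ t i ω) t).1 := by
  cases t with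
  | zero => exact h0
  | succ t =>
    have := measurable_spider (γ := γ) (q := q) (B := B) (B' := B') hG h0 t
      fun s hs => hξ s (Nat.lt_succ_of_le hs)
    simp only [spider_succ_fst]
    fun_prop

lemma measurable_spider_data
    (hG : Measurable fun p : S × EuclideanSpace ℝ (Fin d) => gradient (F p.1) p.2) (t : ℕ) :
    Measurable fun x : EuclideanSpace ℝ (Fin d) × (ℕ × ℕ → S) =>
      spider F γ q B B' x.1 (fun t i => x.2 (t, i)) t :=
  measurable_spider hG measurable_fst
    (ξ := fun t i (x : EuclideanSpace ℝ (Fin d) × (ℕ × ℕ → S)) => x.2 (t, i)) t fun s _ i =>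
    (measurable_pi_apply (s, i)).comp measurable_snd

end Spider

/-! ### Independence of each batch from the past. -/

namespace IsRandomInput

variable {d : ℕ} {S Ω : Type*} [MeasurableSpace S]
  {F : S → EuclideanSpace ℝ (Fin d) → ℝ} {W₀ : Ω → EuclideanSpace ℝ (Fin d)}
  {ξ : ℕ → ℕ → Ω → S} {τ : Ω → ℕ} {T : ℕ} {γ : ℝ} {q B B' : ℕ}

/-- The initial point and the batches before `t`. -/
def pastData (W₀ : Ω → EuclideanSpace ℝ (Fin d)) (ξ : ℕ → ℕ → Ω → S) (t : ℕ) (ω : Ω) :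
    EuclideanSpace ℝ (Fin d) × ({p : ℕ × ℕ | p.1 < t} → S) :=
  (W₀ ω, fun p => ξ p.1.1 p.1.2 ω)

lemma measurable_pastData_sample {t : ℕ} (s i : ℕ) (hs : s < t) :
    Measurable[MeasurableSpace.comap (pastData W₀ ξ t) inferInstance] (ξ s i) := by
  have h2 : Measurable fun x : EuclideanSpace ℝ (Fin d) × ({p : ℕ × ℕ | p.1 < t} → S) =>
    x.2 ⟨(s, i), by simpa using hs⟩ := (measurable_pi_apply _).comp measurable_snd
  exact h2.comp (comap_measurable (pastData W₀ ξ t))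

lemma measurable_pastData_init {t : ℕ} :
    Measurable[MeasurableSpace.comap (pastData W₀ ξ t) inferInstance] W₀ :=
  measurable_fst.comp (comap_measurable (pastData W₀ ξ t))

variable [MeasurableSpace Ω] {P : Measure S} {μ : Measure Ω}

/-- Whatever is determined by the initial point and the batches before `t` is independent of
the batch `t`. -/
lemma indepFun_batch [IsProbabilityMeasure μ] (hr : IsRandomInput P μ W₀ ξ τ T) (t : ℕ)
    {X' : Type*} [MeasurableSpace X'] {X : Ω → X'}
    (hX : Measurable[MeasurableSpace.comap (pastData W₀ ξ t) inferInstance] X) :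
    IndepFun X (fun ω i => ξ t i ω) μ := by
  have hm : ∀ p : ℕ × ℕ, Measurable (ξ p.1 p.2) := fun p => hr.measurable_sample _ _
  have hdisj : Disjoint {p : ℕ × ℕ | p.1 < t} {p : ℕ × ℕ | p.1 = t} := by
    rw [Set.disjoint_left]
    rintro p hp hp'
    simp only [Set.mem_ofPred_eq] at hp hp'
    omega
  have h1 := hr.indep_sample.indepFun_of_disjoint hm hdisj
  have hψ : Measurable fun (x : {p : ℕ × ℕ | p.1 = t} → S) (i : ℕ) => x ⟨(t, i), by simp⟩ :=
    measurable_pi_lambda _ fun i => measurable_pi_apply _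
  have h2 : IndepFun (fun ω (p : {p : ℕ × ℕ | p.1 < t}) => ξ p.1.1 p.1.2 ω)
      (fun ω i => ξ t i ω) μ := h1.comp measurable_id hψ
  have hψ' : Measurable fun x : ℕ × ℕ → S =>
      ((fun p : {p : ℕ × ℕ | p.1 < t} => x p.1), fun i : ℕ => x (t, i)) := by fun_prop
  have h3 : IndepFun W₀ (fun ω => ((fun p : {p : ℕ × ℕ | p.1 < t} => ξ p.1.1 p.1.2 ω),
      fun i => ξ t i ω)) μ := hr.indep_init.comp measurable_id hψ'
  have h4 := IndepFun.prodMk_assoc hr.measurable_init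
    (measurable_pi_lambda _ fun _ => hm _) (measurable_pi_lambda _ fun i => hm (t, i)) h3 h2
  rw [IndepFun_iff_Indep] at h4 ⊢
  exact indep_of_indep_of_le_left h4 hX.comap_le

lemma indepFun_spider_fst [IsProbabilityMeasure μ] (hr : IsRandomInput P μ W₀ ξ τ T)
    (hG : Measurable fun p : S × EuclideanSpace ℝ (Fin d) => gradient (F p.1) p.2) (t : ℕ) :
    IndepFun (fun ω => (spider F γ q B B' (W₀ ω) (fun t i => ξ t i ω) t).1)
      (fun ω i => ξ t i ω) μ :=
  hr.indepFun_batch t (@measurable_spider_fst _ _ _ _ _ _ _ _ _ (_) hG _ measurable_pastData_init _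
    t fun s hs i => measurable_pastData_sample s i hs)

lemma indepFun_spider [IsProbabilityMeasure μ] (hr : IsRandomInput P μ W₀ ξ τ T)
    (hG : Measurable fun p : S × EuclideanSpace ℝ (Fin d) => gradient (F p.1) p.2) (t : ℕ) :
    IndepFun (fun ω => spider F γ q B B' (W₀ ω) (fun t i => ξ t i ω) t)
      (fun ω i => ξ (t + 1) i ω) μ :=
  hr.indepFun_batch (t + 1) (@measurable_spider _ _ _ _ _ _ _ _ _ (_) hG _ measurable_pastData_init _
    t fun s hs i => measurable_pastData_sample s i (Nat.lt_succ_of_le hs))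

lemma iIndepFun_batch (hr : IsRandomInput P μ W₀ ξ τ T) (t : ℕ) :
    iIndepFun (fun i => ξ t i) μ :=
  hr.indep_sample.precomp (g := fun i : ℕ => (t, i)) fun i j h => by simpa using h

end IsRandomInput

/-! ### One-step recursion for the gradient error. -/

section Error

variable {d : ℕ} {S Ω : Type*} [MeasurableSpace S] [MeasurableSpace Ω]
  {P : Measure S} {μ : Measure Ω}
  {F : S → EuclideanSpace ℝ (Fin d) → ℝ} {W₀ : Ω → EuclideanSpace ℝ (Fin d)}
  {ξ : ℕ → ℕ → Ω → S} {τ : Ω → ℕ} {T : ℕ} {α L₀ L₁ Γ Λ γ : ℝ} {q B B' : ℕ}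

lemma IsExpectedSymSmooth.measurable_uncurry_gradient (h : IsExpectedSymSmooth P F α L₀ L₁) :
    Measurable fun p : S × EuclideanSpace ℝ (Fin d) => gradient (F p.1) p.2 :=
  _root_.measurable_uncurry_gradient h.measurable_sample h.differentiable_sample

lemma IsExpectedSymSmooth.measurable_gradient_popLoss (h : IsExpectedSymSmooth P F α L₀ L₁) :
    Measurable (gradient (popLoss P F)) := measurable_gradient h.differentiable_popLoss

/-- The expected error of the gradient estimate, smoothed by `c`. -/
def smoothedError (P : Measure S) (μ : Measure Ω) (F : S → EuclideanSpace ℝ (Fin d) → ℝ) (γ : ℝ)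
    (q B B' : ℕ) (W₀ : Ω → EuclideanSpace ℝ (Fin d)) (ξ : ℕ → ℕ → Ω → S) (c : ℝ) (t : ℕ) :
    ENNReal :=
  ∫⁻ ω, ENNReal.ofReal √(‖(spider F γ q B B' (W₀ ω) (fun t i => ξ t i ω) t).2 -
    gradient (popLoss P F) (spider F γ q B B' (W₀ ω) (fun t i => ξ t i ω) t).1‖ ^ 2 + c) ∂μ

/-- The expected norm of the gradient of the population loss at the iterate `t`. -/
def expectedGradNorm (P : Measure S) (μ : Measure Ω) (F : S → EuclideanSpace ℝ (Fin d) → ℝ)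
    (γ : ℝ) (q B B' : ℕ) (W₀ : Ω → EuclideanSpace ℝ (Fin d)) (ξ : ℕ → ℕ → Ω → S) (t : ℕ) :
    ENNReal :=
  ∫⁻ ω, ENNReal.ofReal ‖gradient (popLoss P F)
    (spider F γ q B B' (W₀ ω) (fun t i => ξ t i ω) t).1‖ ∂μ

variable [IsProbabilityMeasure P] [IsProbabilityMeasure μ]

/-- At an epoch start nothing is inherited: given w_t the error is a centered batch average with
variance at most (b‖∇f‖ + σ)², and √(x² + c) ≤ x + √c. -/
lemma smoothedError_le_of_mod_eq_zero (h : IsExpectedSymSmooth P F α L₀ L₁)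
    (hv : HasUnbiasedBoundedVariance P F Γ Λ) (hr : IsRandomInput P μ W₀ ξ τ T) (hB : 0 < B)
    {b σ : ℝ} (hb : 0 ≤ b) (hσ : 0 ≤ σ)
    (hbσ : ∀ w, (Γ ^ 2 * ‖gradient (popLoss P F) w‖ ^ 2 + Λ ^ 2) / B ≤
      (b * ‖gradient (popLoss P F) w‖ + σ) ^ 2) {c : ℝ} (hc : 0 ≤ c) {t : ℕ} (ht : t % q = 0) :
    smoothedError P μ F γ q B B' W₀ ξ c t ≤
      ENNReal.ofReal b * expectedGradNorm P μ F γ q B B' W₀ ξ t + ENNReal.ofReal (σ + √c) := by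
  have hG := h.measurable_uncurry_gradient
  have hg := h.measurable_gradient_popLoss
  set W : Ω → EuclideanSpace ℝ (Fin d) :=
    fun ω => (spider F γ q B B' (W₀ ω) (fun t i => ξ t i ω) t).1 with hW
  have hWm : Measurable W :=
    measurable_spider_fst hG hr.measurable_init t fun s _ i => hr.measurable_sample s i
  have hYm : Measurable fun ω i => ξ t i ω :=
    measurable_pi_lambda _ fun i => hr.measurable_sample t i
  set Ψ : EuclideanSpace ℝ (Fin d) → (ℕ → S) → ENNReal := fun w y =>
    ENNReal.ofReal √(‖batchGradient F y B w - gradient (popLoss P F) w‖ ^ 2 + c) with hΨ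
  have hΨm : Measurable (Function.uncurry Ψ) := by
    have h1 : Measurable fun p : EuclideanSpace ℝ (Fin d) × (ℕ → S) =>
        batchGradient F p.2 B p.1 :=
      measurable_batchGradient hG (fun i => (measurable_pi_apply i).comp measurable_snd) B
        measurable_fst
    have h2 : Measurable fun p : EuclideanSpace ℝ (Fin d) × (ℕ → S) =>
        gradient (popLoss P F) p.1 := hg.comp measurable_fst
    exact (((h1.sub h2).norm.pow_const 2).add_const c).sqrt.ennreal_ofReal
  have e1 : smoothedError P μ F γ q B B' W₀ ξ c t = ∫⁻ ω, Ψ (W ω) (fun i => ξ t i ω) ∂μ := by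
    refine lintegral_congr fun ω => ?_
    rw [spider_snd_of_mod_eq_zero _ _ ht]
  rw [e1, (hr.indepFun_spider_fst hG t).lintegral_eq hWm hYm hΨm, expectedGradNorm,
    ← lintegral_const_mul _ (by exact (hg.comp hWm).norm.ennreal_ofReal)]
  have e2 : ENNReal.ofReal (σ + √c) = ∫⁻ _ : Ω, ENNReal.ofReal (σ + √c) ∂μ := by simp
  rw [e2, ← lintegral_add_right _ measurable_const]
  refine lintegral_mono fun ω => ?_
  rw [← ENNReal.ofReal_mul hb, ← ENNReal.ofReal_add (by positivity) (by positivity)]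
  set w := W ω
  have hBR : (B : ℝ) ≠ 0 := by positivity
  have key := lintegral_sqrt_norm_add_batch_le (fun i => hr.measurable_sample t i)
    (fun i => hr.law_sample t i) (hr.iIndepFun_batch t)
    (h := fun s => gradient (F s) w - gradient (popLoss P F) w)
    ((hG.comp (measurable_id.prodMk measurable_const)).sub measurable_const) (hv.memLp_sub w)
    (by rw [integral_sub (hv.integrable_gradient w) (integrable_const _), hv.unbiased w]; simp)
    hB 0 hc
  have e3 : ∀ y : ℕ → S, (0 : EuclideanSpace ℝ (Fin d)) + (B : ℝ)⁻¹ • ∑ i ∈ Finset.range B,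
      (gradient (F (y i)) w - gradient (popLoss P F) w) =
      batchGradient F y B w - gradient (popLoss P F) w := fun y => by
    rw [batchGradient, Finset.sum_sub_distrib, smul_sub, zero_add]
    congr 1
    rw [Finset.sum_const, Finset.card_range, ← Nat.cast_smul_eq_nsmul ℝ, smul_smul,
      inv_mul_cancel₀ hBR, one_smul]
  simp only [fun ω' => e3 fun i => ξ t i ω'] at key
  refine key.trans (ENNReal.ofReal_le_ofReal ?_)
  have h1 : (∫ s, ‖gradient (F s) w - gradient (popLoss P F) w‖ ^ 2 ∂P) / B ≤
      (b * ‖gradient (popLoss P F) w‖ + σ) ^ 2 :=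
    (div_le_div_of_nonneg_right (hv.variance_le w) (by positivity)).trans (hbσ w)
  refine Real.sqrt_le_iff.2 ⟨by positivity, ?_⟩
  have h2 : √c ^ 2 = c := Real.sq_sqrt hc
  have h3 : 0 ≤ (b * ‖gradient (popLoss P F) w‖ + σ) * √c := by positivity
  rw [norm_zero]
  nlinarith

/-- The a² in a²(1 + g)² stays under the root. The rest, 2a²g + a²g², is paid for by adding a g
outside, because the root is already at least a. -/
lemma sqrt_add_add_mul_sq_le {e c a g : ℝ} (hc : 0 ≤ c) (ha : 0 ≤ a) (hg : 0 ≤ g) :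
    √(e ^ 2 + (a * (1 + g)) ^ 2 + c) ≤ √(e ^ 2 + (c + a ^ 2)) + a * g := by
  refine Real.sqrt_le_iff.2 ⟨by positivity, ?_⟩
  have h1 : √(e ^ 2 + (c + a ^ 2)) ^ 2 = e ^ 2 + (c + a ^ 2) := Real.sq_sqrt (by positivity)
  have h2 : a ≤ √(e ^ 2 + (c + a ^ 2)) := Real.le_sqrt_of_sq_le (by nlinarith [sq_nonneg e])
  have h3 : a * (a * g) ≤ √(e ^ 2 + (c + a ^ 2)) * (a * g) := by gcongr
  nlinarith

/-- The new error is the old one plus a batch average of centered gradient differences, independent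
of the past given (w_t, v_t). Its variance is bounded by `hD`, because a step is no longer than γ.
-/
lemma smoothedError_succ_le (h : IsExpectedSymSmooth P F α L₀ L₁)
    (hv : HasUnbiasedBoundedVariance P F Γ Λ) (hr : IsRandomInput P μ W₀ ξ τ T) (hB' : 0 < B')
    (hγ : 0 ≤ γ) {a : ℝ} (ha : 0 ≤ a)
    (hD : ∀ w w', ‖w' - w‖ ≤ γ →
      gradDist P F w w' ^ 2 / B' ≤ (a * (1 + ‖gradient (popLoss P F) w‖)) ^ 2)
    {c : ℝ} (hc : 0 ≤ c) {t : ℕ} (ht : (t + 1) % q ≠ 0) :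
    smoothedError P μ F γ q B B' W₀ ξ c (t + 1) ≤
      smoothedError P μ F γ q B B' W₀ ξ (c + a ^ 2) t +
        ENNReal.ofReal a * expectedGradNorm P μ F γ q B B' W₀ ξ t := by
  have hG := h.measurable_uncurry_gradient
  have hg := h.measurable_gradient_popLoss
  set X : Ω → EuclideanSpace ℝ (Fin d) × EuclideanSpace ℝ (Fin d) :=
    fun ω => spider F γ q B B' (W₀ ω) (fun t i => ξ t i ω) t with hX
  have hXm : Measurable X :=
    measurable_spider hG hr.measurable_init t fun s _ i => hr.measurable_sample s i
  have hYm : Measurable fun ω i => ξ (t + 1) i ω :=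
    measurable_pi_lambda _ fun i => hr.measurable_sample (t + 1) i
  set next : EuclideanSpace ℝ (Fin d) × EuclideanSpace ℝ (Fin d) → EuclideanSpace ℝ (Fin d) :=
    fun x => x.1 - γ • (‖x.2‖⁻¹ • x.2) with hnext
  have hnm : Measurable next := by fun_prop
  set Ψ : EuclideanSpace ℝ (Fin d) × EuclideanSpace ℝ (Fin d) → (ℕ → S) → ENNReal := fun x y =>
    ENNReal.ofReal √(‖(x.2 + batchGradient F y B' (next x) - batchGradient F y B' x.1) -
      gradient (popLoss P F) (next x)‖ ^ 2 + c) with hΨ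
  have hΨm : Measurable (Function.uncurry Ψ) := by
    have h1 : ∀ u : EuclideanSpace ℝ (Fin d) × EuclideanSpace ℝ (Fin d) →
        EuclideanSpace ℝ (Fin d), Measurable u → Measurable fun p : (EuclideanSpace ℝ (Fin d) ×
          EuclideanSpace ℝ (Fin d)) × (ℕ → S) => batchGradient F p.2 B' (u p.1) := fun u hu =>
      measurable_batchGradient hG (fun i => (measurable_pi_apply i).comp measurable_snd) B'
        (hu.comp measurable_fst)
    have h2 : Measurable fun p : (EuclideanSpace ℝ (Fin d) ×
          EuclideanSpace ℝ (Fin d)) × (ℕ → S) => gradient (popLoss P F) (next p.1) :=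
      hg.comp (hnm.comp measurable_fst)
    exact (((((measurable_fst.snd.add (h1 next hnm)).sub (h1 Prod.fst measurable_fst)).sub
      h2).norm.pow_const 2).add_const c).sqrt.ennreal_ofReal
  have e1 : smoothedError P μ F γ q B B' W₀ ξ c (t + 1) =
      ∫⁻ ω, Ψ (X ω) (fun i => ξ (t + 1) i ω) ∂μ := by
    refine lintegral_congr fun ω => ?_
    rw [spider_succ_snd _ _ ht, spider_succ_fst]
  rw [e1, (hr.indepFun_spider hG t).lintegral_eq hXm hYm hΨm, expectedGradNorm,
    ← lintegral_const_mul _ (by exact (hg.comp hXm.fst).norm.ennreal_ofReal), smoothedError,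
    ← lintegral_add_right _ (by exact (hg.comp hXm.fst).norm.ennreal_ofReal.const_mul _)]
  refine lintegral_mono fun ω => ?_
  rw [← ENNReal.ofReal_mul ha, ← ENNReal.ofReal_add (by positivity) (by positivity)]
  set x := X ω
  have hBR : (B' : ℝ) ≠ 0 := by positivity
  have hL2 : MemLp (fun s => gradient (F s) (next x) - gradient (F s) x.1) 2 P :=
    (hv.memLp_gradient _).sub (hv.memLp_gradient _)
  have hmean : ∫ s, (gradient (F s) (next x) - gradient (F s) x.1) ∂P =
      gradient (popLoss P F) (next x) - gradient (popLoss P F) x.1 := by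
    rw [integral_sub (hv.integrable_gradient _) (hv.integrable_gradient _), hv.unbiased,
      hv.unbiased]
  have key := lintegral_sqrt_norm_add_batch_le (fun i => hr.measurable_sample (t + 1) i)
    (fun i => hr.law_sample (t + 1) i) (hr.iIndepFun_batch (t + 1))
    (h := fun s => (gradient (F s) (next x) - gradient (F s) x.1) -
      (gradient (popLoss P F) (next x) - gradient (popLoss P F) x.1))
    (((hG.comp (measurable_id.prodMk measurable_const)).sub
      (hG.comp (measurable_id.prodMk measurable_const))).sub measurable_const)
    (hL2.sub (memLp_const _))
    (by rw [integral_sub (hL2.integrable (by norm_num)) (integrable_const _), hmean]; simp)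
    hB' (x.2 - gradient (popLoss P F) x.1) hc
  have e3 : ∀ y : ℕ → S, (x.2 - gradient (popLoss P F) x.1) + (B' : ℝ)⁻¹ •
      ∑ i ∈ Finset.range B', ((gradient (F (y i)) (next x) - gradient (F (y i)) x.1) -
        (gradient (popLoss P F) (next x) - gradient (popLoss P F) x.1)) =
      (x.2 + batchGradient F y B' (next x) - batchGradient F y B' x.1) -
        gradient (popLoss P F) (next x) := fun y => by
    rw [batchGradient, batchGradient, Finset.sum_sub_distrib, Finset.sum_sub_distrib, smul_sub,
      Finset.sum_const, Finset.card_range, ← Nat.cast_smul_eq_nsmul ℝ, smul_smul,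
      inv_mul_cancel₀ hBR, one_smul, smul_sub]
    abel
  simp only [fun ω' => e3 fun i => ξ (t + 1) i ω'] at key
  refine key.trans (ENNReal.ofReal_le_ofReal ?_)
  have hstep : ‖next x - x.1‖ ≤ γ := by
    simp only [hnext]
    rw [sub_sub_cancel_left, norm_neg]
    exact norm_smul_inv_norm_smul_le hγ
  have h1 : (∫ s, ‖(gradient (F s) (next x) - gradient (F s) x.1) -
      (gradient (popLoss P F) (next x) - gradient (popLoss P F) x.1)‖ ^ 2 ∂P) / B' ≤
      (a * (1 + ‖gradient (popLoss P F) x.1‖)) ^ 2 := by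
    refine le_trans (div_le_div_of_nonneg_right ?_ (by positivity)) (hD _ _ hstep)
    have := integral_norm_sub_sq hL2
    rw [hmean, integral_norm_sq_eq_lpNorm_sq hL2] at this
    rw [this, gradDist]
    linarith [sq_nonneg ‖gradient (popLoss P F) (next x) - gradient (popLoss P F) x.1‖]
  refine le_trans (Real.sqrt_le_sqrt ?_) (sqrt_add_add_mul_sq_le hc ha (norm_nonneg _))
  linarith

end Error

/-! ### Averaging over the uniform index. -/

section UniformIndex

variable {d : ℕ} {S Ω : Type*} [MeasurableSpace S] [MeasurableSpace Ω]
  {P : Measure S} {μ : Measure Ω} [IsProbabilityMeasure μ] {W₀ : Ω → EuclideanSpace ℝ (Fin d)}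
  {ξ : ℕ → ℕ → Ω → S} {τ : Ω → ℕ} {T : ℕ}

/-- The expectation at an independent uniform index is the average over the indices. -/
lemma lintegral_uniform_index (hr : IsRandomInput P μ W₀ ξ τ T) (hT : 0 < T) (a : ℕ → ENNReal) :
    ∫⁻ ω, a (τ ω) ∂μ = (T : ENNReal)⁻¹ * ∑ t ∈ Finset.range T, a t := by
  have hms : ∀ t, MeasurableSet {ω | τ ω = t} := fun t =>
    hr.measurable_index (measurableSet_singleton t)
  -- Only the probabilities of the T admissible values are given; they add up to 1, so no mass is
  -- left elsewhere.
  have hlt : ∀ᵐ ω ∂μ, τ ω < T := by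
    have hU : {ω | τ ω < T} = ⋃ t ∈ Finset.range T, {ω | τ ω = t} := by
      ext ω; simp
    have h1 : μ {ω | τ ω < T} = 1 := by
      rw [hU, measure_biUnion_finset _ fun t _ => hms t]
      · rw [Finset.sum_congr rfl fun t ht => hr.uniform_index t (Finset.mem_range.1 ht),
          Finset.sum_const, Finset.card_range, nsmul_eq_mul]
        exact ENNReal.mul_inv_cancel (by exact_mod_cast hT.ne') (by simp)
      · intro s _ t _ hst
        exact Set.disjoint_left.2 fun ω hs ht => hst (hs.symm.trans ht)
    exact (prob_compl_eq_zero_iff (hr.measurable_index measurableSet_Iio)).2 h1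
  have hae : ∀ᵐ ω ∂μ, a (τ ω) =
      ∑ t ∈ Finset.range T, {ω | τ ω = t}.indicator (fun _ => a t) ω := by
    filter_upwards [hlt] with ω hω
    rw [Finset.sum_eq_single (τ ω)]
    · simp
    · intro t _ ht
      exact Set.indicator_of_notMem (by simpa using ht.symm) _
    · intro ht
      exact absurd (Finset.mem_range.2 hω) ht
  rw [lintegral_congr_ae hae, lintegral_finsetSum _ fun t _ => measurable_const.indicator (hms t),
    Finset.mul_sum]
  refine Finset.sum_congr rfl fun t ht => ?_
  rw [lintegral_indicator_const (hms t), hr.uniform_index t (Finset.mem_range.1 ht), mul_comm]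

end UniformIndex

/-! ### Integrability, error over an epoch and telescoping. -/

section Convergence

variable {d : ℕ} {S Ω : Type*} {F : S → EuclideanSpace ℝ (Fin d) → ℝ}
  {W₀ : Ω → EuclideanSpace ℝ (Fin d)}
  {ξ : ℕ → ℕ → Ω → S} {τ : Ω → ℕ} {T : ℕ} {α L₀ L₁ Γ Λ γ ε : ℝ} {q B B' : ℕ}

/-- The random iterate `w_t`. -/
def spiderIterate (F : S → EuclideanSpace ℝ (Fin d) → ℝ) (γ : ℝ) (q B B' : ℕ)
    (W₀ : Ω → EuclideanSpace ℝ (Fin d)) (ξ : ℕ → ℕ → Ω → S) (t : ℕ) (ω : Ω) :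
    EuclideanSpace ℝ (Fin d) :=
  (spider F γ q B B' (W₀ ω) (fun t i => ξ t i ω) t).1

/-- The random gradient estimate `v_t`. -/
def spiderEstimate (F : S → EuclideanSpace ℝ (Fin d) → ℝ) (γ : ℝ) (q B B' : ℕ)
    (W₀ : Ω → EuclideanSpace ℝ (Fin d)) (ξ : ℕ → ℕ → Ω → S) (t : ℕ) (ω : Ω) :
    EuclideanSpace ℝ (Fin d) :=
  (spider F γ q B B' (W₀ ω) (fun t i => ξ t i ω) t).2

lemma norm_spiderIterate_succ_sub_le (hγ : 0 ≤ γ) (t : ℕ) (ω : Ω) :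
    ‖spiderIterate F γ q B B' W₀ ξ (t + 1) ω - spiderIterate F γ q B B' W₀ ξ t ω‖ ≤ γ := by
  simp only [spiderIterate, spider_succ_fst]
  rw [sub_sub_cancel_left, norm_neg]
  exact norm_smul_inv_norm_smul_le hγ

variable [MeasurableSpace S] [MeasurableSpace Ω] {P : Measure S} {μ : Measure Ω}

lemma measurable_spiderIterate (h : IsExpectedSymSmooth P F α L₀ L₁)
    (hr : IsRandomInput P μ W₀ ξ τ T) (t : ℕ) :
    Measurable (spiderIterate F γ q B B' W₀ ξ t) :=
  measurable_spider_fst h.measurable_uncurry_gradient hr.measurable_init t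
    fun s _ i => hr.measurable_sample s i

lemma measurable_spiderEstimate (h : IsExpectedSymSmooth P F α L₀ L₁)
    (hr : IsRandomInput P μ W₀ ξ τ T) (t : ℕ) :
    Measurable (spiderEstimate F γ q B B' W₀ ξ t) :=
  (measurable_spider h.measurable_uncurry_gradient hr.measurable_init t
    fun s _ i => hr.measurable_sample s i).snd

/-- The `L²` Lipschitz estimate for the sample gradients on balls of radius `γ`. -/
def IsGradLipschitzOnBalls (P : Measure S) (F : S → EuclideanSpace ℝ (Fin d) → ℝ) (γ ε : ℝ) :
    Prop :=
  ∀ w w', ‖w' - w‖ ≤ γ →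
    gradDist P F w w' ≤ ε / (4 * γ) * (1 + ‖gradient (popLoss P F) w‖) * ‖w' - w‖

lemma IsGradLipschitzOnBalls.gradDist_le (H : IsGradLipschitzOnBalls P F γ ε) (hγ : 0 < γ)
    (hε : 0 < ε) {w w' : EuclideanSpace ℝ (Fin d)} (hw : ‖w' - w‖ ≤ γ) :
    gradDist P F w w' ≤ ε / 4 * (1 + ‖gradient (popLoss P F) w‖) := by
  refine (H w w' hw).trans ?_
  calc ε / (4 * γ) * (1 + ‖gradient (popLoss P F) w‖) * ‖w' - w‖
      ≤ ε / (4 * γ) * (1 + ‖gradient (popLoss P F) w‖) * γ := by gcongr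
    _ = _ := by field_simp

lemma IsGradLipschitzOnBalls.gradDist_sq_div_le (H : IsGradLipschitzOnBalls P F γ ε) (hγ : 0 < γ)
    (hε : 0 < ε) (hB' : 0 < B') {w w' : EuclideanSpace ℝ (Fin d)} (hw : ‖w' - w‖ ≤ γ) :
    gradDist P F w w' ^ 2 / B' ≤
      (ε / (4 * √B') * (1 + ‖gradient (popLoss P F) w‖)) ^ 2 := by
  have h1 := H.gradDist_le hγ hε hw
  have h2 : √(B' : ℝ) ^ 2 = B' := Real.sq_sqrt (by positivity)
  have h3 : (ε / (4 * √B') * (1 + ‖gradient (popLoss P F) w‖)) ^ 2 =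
      (ε / 4 * (1 + ‖gradient (popLoss P F) w‖)) ^ 2 / B' := by
    rw [mul_pow, div_pow, mul_pow, h2]
    field_simp
  rw [h3]
  have := gradDist_nonneg (P := P) (F := F) w w'
  gcongr

variable [IsProbabilityMeasure P]

lemma IsGradLipschitzOnBalls.step_descent (H : IsGradLipschitzOnBalls P F γ ε)
    (h : IsExpectedSymSmooth P F α L₀ L₁) (hv : HasUnbiasedBoundedVariance P F Γ Λ)
    (hγ : 0 < γ) (hε : 0 < ε) (w v : EuclideanSpace ℝ (Fin d)) :
    popLoss P F (w - γ • (‖v‖⁻¹ • v)) ≤ popLoss P F w - γ * ‖gradient (popLoss P F) w‖ +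
      2 * γ * ‖v - gradient (popLoss P F) w‖ +
        γ * (ε / 8) * (1 + ‖gradient (popLoss P F) w‖) := by
  have := normalized_step_descent h.differentiable_popLoss hγ.le (K := ε / (4 * γ)) (w := w)
    (by positivity) (fun y hy => (norm_gradient_popLoss_sub_le hv w y).trans (H w y hy)) v
  have e : ε / (4 * γ) / 2 * (1 + ‖gradient (popLoss P F) w‖) * γ ^ 2 =
      γ * (ε / 8) * (1 + ‖gradient (popLoss P F) w‖) := by
    field_simp
    ring
  linarith

variable [IsProbabilityMeasure μ]

/-- An exact normalized step from the initial point cannot go below inf f, so the descent inequality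
bounds γ‖∇f(w₀)‖ by 2 (f(w₀) - inf f) + γ, which is integrable. -/
lemma integrable_norm_gradient_init (H : IsGradLipschitzOnBalls P F γ ε)
    (h : IsExpectedSymSmooth P F α L₀ L₁) (hv : HasUnbiasedBoundedVariance P F Γ Λ)
    (hbdd : BddBelow (Set.range (popLoss P F))) (hr : IsRandomInput P μ W₀ ξ τ T)
    (hf0 : Integrable (fun ω => popLoss P F (W₀ ω)) μ)
    (hγ : 0 < γ) (hε : 0 < ε) (hε1 : ε < 1) :
    Integrable (fun ω => ‖gradient (popLoss P F) (W₀ ω)‖) μ := by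
  refine Integrable.mono' (((hf0.sub (integrable_const (⨅ w, popLoss P F w))).const_mul
    (2 / γ)).add (integrable_const 1))
    (h.measurable_gradient_popLoss.comp hr.measurable_init).norm.aestronglyMeasurable
    (.of_forall fun ω => ?_)
  have h1 := H.step_descent h hv hγ hε (W₀ ω) (gradient (popLoss P F) (W₀ ω))
  have h2 := ciInf_le hbdd (W₀ ω - γ • (‖gradient (popLoss P F) (W₀ ω)‖⁻¹ •
    gradient (popLoss P F) (W₀ ω)))
  rw [sub_self, norm_zero, mul_zero, add_zero] at h1
  simp only [norm_norm, Pi.add_apply, Pi.sub_apply]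
  set g := ‖gradient (popLoss P F) (W₀ ω)‖
  have hg : 0 ≤ g := norm_nonneg _
  have h3 : γ * (ε / 8) * (1 + g) ≤ γ * (1 / 8) * (1 + g) := by gcongr
  have h4 : γ * g ≤ 2 * (popLoss P F (W₀ ω) - ⨅ w, popLoss P F w) + γ := by
    have : 0 ≤ γ * g := by positivity
    linarith
  have h5 : g ≤ (2 * (popLoss P F (W₀ ω) - ⨅ w, popLoss P F w) + γ) / γ := by
    rw [le_div_iff₀ hγ]; linarith
  have h6 : (2 * (popLoss P F (W₀ ω) - ⨅ w, popLoss P F w) + γ) / γ =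
      2 / γ * (popLoss P F (W₀ ω) - ⨅ w, popLoss P F w) + 1 := by
    field_simp
  linarith

/-- Each step changes the gradient by at most ε/4 · (1 + ‖∇f‖), so integrability propagates. -/
lemma integrable_norm_gradient (H : IsGradLipschitzOnBalls P F γ ε)
    (h : IsExpectedSymSmooth P F α L₀ L₁) (hv : HasUnbiasedBoundedVariance P F Γ Λ)
    (hbdd : BddBelow (Set.range (popLoss P F))) (hr : IsRandomInput P μ W₀ ξ τ T)
    (hf0 : Integrable (fun ω => popLoss P F (W₀ ω)) μ)
    (hγ : 0 < γ) (hε : 0 < ε) (hε1 : ε < 1) (t : ℕ) :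
    Integrable (fun ω => ‖gradient (popLoss P F) (spiderIterate F γ q B B' W₀ ξ t ω)‖) μ := by
  induction t with
  | zero => exact integrable_norm_gradient_init H h hv hbdd hr hf0 hγ hε hε1
  | succ t ih =>
    refine Integrable.mono' (ih.add (((integrable_const (1 : ℝ)).add ih).const_mul (ε / 4)))
      (h.measurable_gradient_popLoss.comp
        (measurable_spiderIterate h hr (t + 1))).norm.aestronglyMeasurable
      (.of_forall fun ω => ?_)
    have h1 := H.gradDist_le hγ hε (norm_spiderIterate_succ_sub_le (F := F) (q := q) (B := B)
      (B' := B') (W₀ := W₀) (ξ := ξ) hγ.le t ω)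
    have h2 := norm_gradient_popLoss_sub_le hv (spiderIterate F γ q B B' W₀ ξ t ω)
      (spiderIterate F γ q B B' W₀ ξ (t + 1) ω)
    have h3 := norm_sub_norm_le (gradient (popLoss P F) (spiderIterate F γ q B B' W₀ ξ (t + 1) ω))
      (gradient (popLoss P F) (spiderIterate F γ q B B' W₀ ξ t ω))
    simp only [norm_norm, Pi.add_apply]
    linarith

/-- Unrolling the one-step recursion back to the epoch start: each step moves a² into c, hence the
induction is over all c, and releases one term a G. -/
lemma smoothedError_epoch_le (h : IsExpectedSymSmooth P F α L₀ L₁)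
    (hv : HasUnbiasedBoundedVariance P F Γ Λ) (hr : IsRandomInput P μ W₀ ξ τ T)
    (hB : 0 < B) (hB' : 0 < B') (hγ : 0 ≤ γ) {a b σ : ℝ} (ha : 0 ≤ a) (hb : 0 ≤ b) (hσ : 0 ≤ σ)
    (hbσ : ∀ w, (Γ ^ 2 * ‖gradient (popLoss P F) w‖ ^ 2 + Λ ^ 2) / B ≤
      (b * ‖gradient (popLoss P F) w‖ + σ) ^ 2)
    (hD : ∀ w w', ‖w' - w‖ ≤ γ →
      gradDist P F w w' ^ 2 / B' ≤ (a * (1 + ‖gradient (popLoss P F) w‖)) ^ 2)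
    {G : ℕ → ℝ} (hG0 : ∀ t, 0 ≤ G t)
    (hG : ∀ t, expectedGradNorm P μ F γ q B B' W₀ ξ t = ENNReal.ofReal (G t))
    (n : ℕ) {j : ℕ} (hj : j < q) {c : ℝ} (hc : 0 ≤ c) :
    smoothedError P μ F γ q B B' W₀ ξ c (q * n + j) ≤ ENNReal.ofReal
      (b * G (q * n) + (σ + √(c + j * a ^ 2)) + a * ∑ i ∈ Finset.range j, G (q * n + i)) := by
  induction j generalizing c with
  | zero =>
    refine (smoothedError_le_of_mod_eq_zero h hv hr hB hb hσ hbσ hc (by simp)).trans ?_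
    rw [add_zero, hG, ← ENNReal.ofReal_mul hb,
      ← ENNReal.ofReal_add (mul_nonneg hb (hG0 _)) (by positivity)]
    simp
  | succ j ih =>
    have hmod : (q * n + j + 1) % q ≠ 0 := by
      rw [add_assoc, Nat.mul_add_mod, Nat.mod_eq_of_lt hj]
      omega
    refine (smoothedError_succ_le h hv hr hB' hγ ha hD hc hmod).trans ?_
    have hs : 0 ≤ ∑ i ∈ Finset.range j, G (q * n + i) := Finset.sum_nonneg fun i _ => hG0 _
    have h1 := hG0 (q * n)
    have h2 := hG0 (q * n + j)
    refine (add_le_add_left (ih (by omega) (by positivity)) _).trans ?_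
    rw [hG, ← ENNReal.ofReal_mul ha, ← ENNReal.ofReal_add (by positivity) (by positivity)]
    refine ENNReal.ofReal_le_ofReal (le_of_eq ?_)
    have e : c + a ^ 2 + (j : ℝ) * a ^ 2 = c + ((j + 1 : ℕ) : ℝ) * a ^ 2 := by push_cast; ring
    rw [Finset.sum_range_succ, e]
    ring

/-- The variance of a large minibatch gradient. -/
lemma variance_div_batch_le {g : ℝ} (hε : 0 < ε) (hq : 0 < q) (hg : 0 ≤ g)
    (hΛ : 0 < Λ)
    (hB : max (576 * Λ ^ 2 / ε ^ 2) (2304 * Γ ^ 2 * (q : ℝ) ^ 2) ≤ (B : ℝ)) :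
    (Γ ^ 2 * g ^ 2 + Λ ^ 2) / B ≤ (1 / (48 * q) * g + ε / 24) ^ 2 := by
  have hq' : (0 : ℝ) < q := by exact_mod_cast hq
  have h1 := (le_max_left _ _).trans hB
  have h2 := (le_max_right _ _).trans hB
  have hB0 : (0 : ℝ) < B := lt_of_lt_of_le (by positivity) h1
  -- Here 576 = 24² and 2304 = 48². The two variance terms are bounded separately and recombined by
  -- x² + y² ≤ (x + y)².
  have h3 : Λ ^ 2 / B ≤ (ε / 24) ^ 2 := by
    rw [div_le_iff₀ hB0]
    rw [div_le_iff₀ (by positivity)] at h1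
    nlinarith
  have h4 : Γ ^ 2 * g ^ 2 / B ≤ (1 / (48 * q) * g) ^ 2 := by
    rw [div_le_iff₀ hB0]
    have : Γ ^ 2 ≤ (1 / (48 * q)) ^ 2 * (B : ℝ) := by
      rw [div_pow, one_pow, one_div_mul_eq_div, le_div_iff₀ (by positivity)]
      nlinarith
    calc Γ ^ 2 * g ^ 2 ≤ (1 / (48 * q)) ^ 2 * (B : ℝ) * g ^ 2 := by gcongr
      _ = _ := by ring
  rw [add_div]
  have : 0 ≤ 1 / (48 * (q : ℝ)) * g * (ε / 24) := by positivity
  nlinarith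

/-- The condition with 2304 = 48² gives 48 q ε ≤ √B', which keeps the linear coefficient of order
1/q. The one with 576 controls the noise accumulated over q steps, as 16 · 576 = 96². -/
lemma lipschitz_div_batch_le (hε : 0 < ε) (hq : 0 < q)
    (hB' : max (576 * (q : ℝ)) (2304 * (q : ℝ) ^ 2 * ε ^ 2) ≤ (B' : ℝ)) :
    ε / (4 * √B') ≤ 1 / (192 * q) ∧ √(q * (ε / (4 * √B')) ^ 2) ≤ ε / 96 := by
  have hq' : (0 : ℝ) < q := by exact_mod_cast hq
  have h1 := (le_max_left _ _).trans hB'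
  have h2 := (le_max_right _ _).trans hB'
  have hB0 : (0 : ℝ) < B' := lt_of_lt_of_le (by positivity) h1
  have hs : √(B' : ℝ) ^ 2 = B' := Real.sq_sqrt hB0.le
  have hs0 : 0 < √(B' : ℝ) := Real.sqrt_pos.2 hB0
  constructor
  · have : 48 * q * ε ≤ √(B' : ℝ) := Real.le_sqrt_of_sq_le (by nlinarith)
    rw [div_le_div_iff₀ (by positivity) (by positivity)]
    linarith
  · refine Real.sqrt_le_iff.2 ⟨by positivity, ?_⟩
    rw [div_pow, mul_pow, hs, ← mul_div_assoc, div_le_iff₀ (by positivity)]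
    nlinarith [sq_nonneg ε]

lemma sum_range_mul_le_of_epoch {u v : ℕ → ℝ} (hu : ∀ n, ∑ j ∈ Finset.range q, u (q * n + j) ≤
    ∑ j ∈ Finset.range q, v (q * n + j)) (K : ℕ) :
    ∑ t ∈ Finset.range (q * K), u t ≤ ∑ t ∈ Finset.range (q * K), v t := by
  induction K with
  | zero => simp
  | succ K ih =>
    rw [Nat.mul_succ, Finset.sum_range_add, Finset.sum_range_add]
    exact add_le_add ih (hu K)

/-- The expected norm of the gradient at the iterate `t`. -/
def meanGradNorm (P : Measure S) (μ : Measure Ω) (F : S → EuclideanSpace ℝ (Fin d) → ℝ)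
    (γ : ℝ) (q B B' : ℕ) (W₀ : Ω → EuclideanSpace ℝ (Fin d)) (ξ : ℕ → ℕ → Ω → S) (t : ℕ) : ℝ :=
  ∫ ω, ‖gradient (popLoss P F) (spiderIterate F γ q B B' W₀ ξ t ω)‖ ∂μ

/-- The error of the gradient estimate at the iterate `t`. -/
def errorNorm (P : Measure S) (F : S → EuclideanSpace ℝ (Fin d) → ℝ)
    (γ : ℝ) (q B B' : ℕ) (W₀ : Ω → EuclideanSpace ℝ (Fin d)) (ξ : ℕ → ℕ → Ω → S) (t : ℕ)
    (ω : Ω) : ℝ :=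
  ‖spiderEstimate F γ q B B' W₀ ξ t ω -
    gradient (popLoss P F) (spiderIterate F γ q B B' W₀ ξ t ω)‖

/-- The expected error of the gradient estimate within an epoch. -/
lemma integrable_errorNorm_and_integral_le (H : IsGradLipschitzOnBalls P F γ ε)
    (h : IsExpectedSymSmooth P F α L₀ L₁) (hv : HasUnbiasedBoundedVariance P F Γ Λ)
    (hbdd : BddBelow (Set.range (popLoss P F))) (hr : IsRandomInput P μ W₀ ξ τ T)
    (hf0 : Integrable (fun ω => popLoss P F (W₀ ω)) μ)
    (hγ : 0 < γ) (hε : 0 < ε) (hε1 : ε < 1) (hΛ : 0 < Λ) (hq : 0 < q)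
    (hB : max (576 * Λ ^ 2 / ε ^ 2) (2304 * Γ ^ 2 * (q : ℝ) ^ 2) ≤ (B : ℝ))
    (hB' : max (576 * (q : ℝ)) (2304 * (q : ℝ) ^ 2 * ε ^ 2) ≤ (B' : ℝ))
    (n : ℕ) {j : ℕ} (hj : j < q) :
    Integrable (errorNorm P F γ q B B' W₀ ξ (q * n + j)) μ ∧
      ∫ ω, errorNorm P F γ q B B' W₀ ξ (q * n + j) ω ∂μ ≤
        1 / (48 * q) * meanGradNorm P μ F γ q B B' W₀ ξ (q * n) + 5 / 96 * ε +
          1 / (192 * q) *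
            ∑ i ∈ Finset.range q, meanGradNorm P μ F γ q B B' W₀ ξ (q * n + i) := by
  have hq' : (0 : ℝ) < q := by exact_mod_cast hq
  have hBpos : 0 < B := by
    have : (0 : ℝ) < B := lt_of_lt_of_le (by positivity) ((le_max_left _ _).trans hB)
    exact_mod_cast this
  have hBpos' : 0 < B' := by
    have : (0 : ℝ) < B' := lt_of_lt_of_le (by positivity) ((le_max_left _ _).trans hB')
    exact_mod_cast this
  have hWm := measurable_spiderIterate (γ := γ) (q := q) (B := B) (B' := B') h hr
  have hVm := measurable_spiderEstimate (γ := γ) (q := q) (B := B) (B' := B') h hr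
  have hgm := h.measurable_gradient_popLoss
  have hgi := integrable_norm_gradient (q := q) (B := B) (B' := B') H h hv hbdd hr hf0 hγ hε hε1
  set G : ℕ → ℝ := meanGradNorm P μ F γ q B B' W₀ ξ
  have hG0 : ∀ t, 0 ≤ G t := fun t => integral_nonneg fun ω => norm_nonneg _
  have hGe : ∀ t, expectedGradNorm P μ F γ q B B' W₀ ξ t = ENNReal.ofReal (G t) := fun t =>
    (ofReal_integral_eq_lintegral_ofReal (hgi t) (.of_forall fun ω => norm_nonneg _)).symm
  clear_value G
  have ha0 : 0 ≤ ε / (4 * √B') := by positivity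
  obtain ⟨ha1, ha2⟩ := lipschitz_div_batch_le (ε := ε) hε hq hB'
  -- With c = 0 the smoothed error is the true one. The constants ε/24 and ε/96 add up to 5ε/96.
  have h1 := smoothedError_epoch_le h hv hr hBpos hBpos' hγ.le ha0
    (b := 1 / (48 * q)) (σ := ε / 24) (by positivity) (by positivity)
    (fun w => variance_div_batch_le hε hq (norm_nonneg _) hΛ hB)
    (fun w w' hw => H.gradDist_sq_div_le hγ hε hBpos' hw) hG0 hGe n hj le_rfl
  have h2 : √(0 + (j : ℝ) * (ε / (4 * √B')) ^ 2) ≤ ε / 96 := by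
    refine le_trans (Real.sqrt_le_sqrt ?_) ha2
    rw [zero_add]
    gcongr
  have h3 : ∑ i ∈ Finset.range j, G (q * n + i) ≤ ∑ i ∈ Finset.range q, G (q * n + i) :=
    Finset.sum_le_sum_of_subset_of_nonneg (Finset.range_mono hj.le) fun i _ _ => hG0 _
  have h4 : 0 ≤ ∑ i ∈ Finset.range j, G (q * n + i) := Finset.sum_nonneg fun i _ => hG0 _
  have h5 : ε / (4 * √B') * ∑ i ∈ Finset.range j, G (q * n + i) ≤
    1 / (192 * q) * ∑ i ∈ Finset.range q, G (q * n + i) := by gcongr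
  have hm : Measurable fun ω => errorNorm P F γ q B B' W₀ ξ (q * n + j) ω :=
    ((hVm _).sub (hgm.comp (hWm _))).norm
  have h6 : ∫⁻ ω, ENNReal.ofReal (errorNorm P F γ q B B' W₀ ξ (q * n + j) ω) ∂μ ≤ ENNReal.ofReal
      (1 / (48 * q) * G (q * n) + 5 / 96 * ε +
        1 / (192 * q) * ∑ i ∈ Finset.range q, G (q * n + i)) := by
    refine le_trans (le_of_eq ?_) (h1.trans (ENNReal.ofReal_le_ofReal (by linarith)))
    refine lintegral_congr fun ω => ?_
    rw [add_zero, Real.sqrt_sq (norm_nonneg _)]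
    rfl
  have hR0 : 0 ≤ 1 / (48 * q) * G (q * n) + 5 / 96 * ε +
        1 / (192 * q) * ∑ i ∈ Finset.range q, G (q * n + i) := by
    have := hG0 (q * n)
    have := h4.trans h3
    positivity
  have he0 : 0 ≤ᵐ[μ] errorNorm P F γ q B B' W₀ ξ (q * n + j) := .of_forall fun ω => norm_nonneg _
  refine ⟨?_, ?_⟩
  · refine ⟨hm.aestronglyMeasurable, ?_⟩
    rw [hasFiniteIntegral_iff_ofReal he0]
    exact h6.trans_lt ENNReal.ofReal_lt_top
  · rw [integral_eq_lintegral_of_nonneg_ae he0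
      hm.aestronglyMeasurable]
    exact ENNReal.toReal_le_of_le_ofReal hR0 h6

/-- Summing over the q positions of an epoch cancels the factors 1/q, and 1/48 + 1/192 = 5/192. -/
lemma sum_epoch_errors_le (hq : 0 < q) {D G : ℕ → ℝ} (hG0 : ∀ t, 0 ≤ G t)
    (hD : ∀ n, ∀ j < q, D (q * n + j) ≤ 1 / (48 * q) * G (q * n) + 5 / 96 * ε +
      1 / (192 * q) * ∑ i ∈ Finset.range q, G (q * n + i)) (K : ℕ) :
    ∑ t ∈ Finset.range (q * K), D t ≤
      5 / 192 * ∑ t ∈ Finset.range (q * K), G t + (q * K : ℕ) * (5 / 96 * ε) := by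
  have hq' : (0 : ℝ) < q := by exact_mod_cast hq
  have hsum : ∑ t ∈ Finset.range (q * K), D t ≤
      ∑ t ∈ Finset.range (q * K), (5 / 192 * G t + 5 / 96 * ε) := by
    refine sum_range_mul_le_of_epoch (fun n => ?_) K
    have h1 : ∑ j ∈ Finset.range q, D (q * n + j) ≤ ∑ _j ∈ Finset.range q,
        (1 / (48 * q) * G (q * n) + 5 / 96 * ε +
          1 / (192 * q) * ∑ i ∈ Finset.range q, G (q * n + i)) :=
      Finset.sum_le_sum fun j hj => hD n j (Finset.mem_range.1 hj)
    have h2 : G (q * n) ≤ ∑ i ∈ Finset.range q, G (q * n + i) := by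
      have := Finset.single_le_sum (f := fun i => G (q * n + i)) (fun i _ => hG0 _)
        (Finset.mem_range.2 hq)
      simpa using this
    rw [Finset.sum_const, Finset.card_range, nsmul_eq_mul] at h1
    rw [Finset.sum_add_distrib, ← Finset.mul_sum, Finset.sum_const, Finset.card_range,
      nsmul_eq_mul]
    refine h1.trans ?_
    have e : (q : ℝ) * (1 / (48 * q) * G (q * n) + 5 / 96 * ε +
        1 / (192 * q) * ∑ i ∈ Finset.range q, G (q * n + i)) = 1 / 48 * G (q * n) +
        q * (5 / 96 * ε) + 1 / 192 * ∑ i ∈ Finset.range q, G (q * n + i) := by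
      field_simp
    rw [e]
    linarith
  rwa [Finset.sum_add_distrib, ← Finset.mul_sum, Finset.sum_const, Finset.card_range,
    nsmul_eq_mul] at hsum

/-- Telescoping the descent inequality over all iterations. -/
lemma sum_meanGradNorm_le {K : ℕ} (H : IsGradLipschitzOnBalls P F γ ε)
    (h : IsExpectedSymSmooth P F α L₀ L₁) (hv : HasUnbiasedBoundedVariance P F Γ Λ)
    (hbdd : BddBelow (Set.range (popLoss P F))) (hr : IsRandomInput P μ W₀ ξ τ T)
    (hf0 : Integrable (fun ω => popLoss P F (W₀ ω)) μ)
    (hγ : 0 < γ) (hε : 0 < ε) (hε1 : ε < 1) (hΛ : 0 < Λ) (hq : 0 < q)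
    (hB : max (576 * Λ ^ 2 / ε ^ 2) (2304 * Γ ^ 2 * (q : ℝ) ^ 2) ≤ (B : ℝ))
    (hB' : max (576 * (q : ℝ)) (2304 * (q : ℝ) ^ 2 * ε ^ 2) ≤ (B' : ℝ)) :
    5 / 16 * γ * ∑ t ∈ Finset.range (q * K), meanGradNorm P μ F γ q B B' W₀ ξ t ≤
      (∫ ω, popLoss P F (W₀ ω) ∂μ - ⨅ w, popLoss P F w) + ((q * K : ℕ) : ℝ) * γ * ε / 4 := by
  have herr := fun n j hj => integrable_errorNorm_and_integral_le H h hv hbdd hr hf0 hγ hε hε1 hΛ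
    hq hB hB' n (j := j) hj
  have hgi := integrable_norm_gradient (q := q) (B := B) (B' := B') H h hv hbdd hr hf0 hγ hε hε1
  have hWm := measurable_spiderIterate (γ := γ) (q := q) (B := B) (B' := B') h hr
  set W := spiderIterate F γ q B B' W₀ ξ
  set G : ℕ → ℝ := meanGradNorm P μ F γ q B B' W₀ ξ
  have hG0 : ∀ t, 0 ≤ G t := fun t => integral_nonneg fun ω => norm_nonneg _
  set D : ℕ → ℝ := fun t => ∫ ω, errorNorm P F γ q B B' W₀ ξ t ω ∂μ
  have hDi : ∀ t, Integrable (fun ω => errorNorm P F γ q B B' W₀ ξ t ω) μ := by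
    intro t
    have := (herr (t / q) (t % q) (Nat.mod_lt _ hq)).1
    rwa [Nat.div_add_mod] at this
  have hsum := sum_epoch_errors_le (D := D) hq hG0 (fun n j hj => (herr n j hj).2) K
  have hdesc : ∀ t ω, popLoss P F (W (t + 1) ω) ≤ popLoss P F (W t ω) -
      γ * ‖gradient (popLoss P F) (W t ω)‖ +
      2 * γ * errorNorm P F γ q B B' W₀ ξ t ω +
      γ * (ε / 8) * (1 + ‖gradient (popLoss P F) (W t ω)‖) := fun t ω =>
    H.step_descent h hv hγ hε (W t ω) (spiderEstimate F γ q B B' W₀ ξ t ω)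
  have hfm : Measurable (popLoss P F) := h.differentiable_popLoss.continuous.measurable
  have hrhs : ∀ t, Integrable (fun ω => popLoss P F (W t ω)) μ →
      Integrable (fun ω => popLoss P F (W t ω) -
      γ * ‖gradient (popLoss P F) (W t ω)‖ +
      2 * γ * errorNorm P F γ q B B' W₀ ξ t ω +
      γ * (ε / 8) * (1 + ‖gradient (popLoss P F) (W t ω)‖)) μ := fun t ht =>
    ((ht.sub ((hgi t).const_mul γ)).add ((hDi t).const_mul (2 * γ))).add
      (((integrable_const 1).add (hgi t)).const_mul _)
  -- The loss at the next iterate lies between inf f and the integrable right side of the descent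
  -- inequality.
  have hfi : ∀ t, Integrable (fun ω => popLoss P F (W t ω)) μ := by
    intro t
    induction t with
    | zero => exact hf0
    | succ t ih =>
      refine integrable_of_le_of_le (hfm.comp (hWm _)).aestronglyMeasurable
        (.of_forall fun ω => ciInf_le hbdd (W (t + 1) ω)) (.of_forall fun ω => hdesc t ω)
        (integrable_const _) (hrhs t ih)
  have hstep : ∀ t, ∫ ω, popLoss P F (W (t + 1) ω) ∂μ ≤ ∫ ω, popLoss P F (W t ω) ∂μ -
      γ * G t + 2 * γ * D t + γ * (ε / 8) * (1 + G t) := by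
    intro t
    refine (integral_mono (hfi (t + 1)) (hrhs t (hfi t)) (hdesc t)).trans (le_of_eq ?_)
    have i1 := (hfi t).sub ((hgi t).const_mul γ)
    have i2 := i1.add ((hDi t).const_mul (2 * γ))
    have i3 : Integrable (fun ω => 1 + ‖gradient (popLoss P F) (W t ω)‖) μ :=
      (integrable_const 1).add (hgi t)
    refine (integral_add i2 (i3.const_mul _)).trans ?_
    congr 1
    · refine (integral_add i1 ((hDi t).const_mul (2 * γ))).trans ?_
      congr 1
      · refine (integral_sub (hfi t) ((hgi t).const_mul γ)).trans ?_
        rw [integral_const_mul]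
        rfl
      · rw [integral_const_mul]
    · rw [integral_const_mul, integral_add (integrable_const 1) (hgi t)]
      simp [G, W, meanGradNorm]
  have htel : ∀ N : ℕ, ∫ ω, popLoss P F (W N ω) ∂μ ≤ ∫ ω, popLoss P F (W₀ ω) ∂μ -
      γ * ∑ t ∈ Finset.range N, G t + 2 * γ * ∑ t ∈ Finset.range N, D t +
      γ * (ε / 8) * (N + ∑ t ∈ Finset.range N, G t) := by
    intro N
    induction N with
    | zero => simp [W, spiderIterate, spider]
    | succ N ih =>
      simp only [Finset.sum_range_succ]
      push_cast
      linarith [hstep N]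
  have hinf : ⨅ w, popLoss P F w ≤ ∫ ω, popLoss P F (W (q * K) ω) ∂μ := by
    have := integral_mono (integrable_const (⨅ w, popLoss P F w)) (hfi (q * K))
      (fun ω => ciInf_le hbdd (W (q * K) ω))
    simpa using this
  have hT := htel (q * K)
  set s := ∑ t ∈ Finset.range (q * K), G t with hs
  have hs0 : 0 ≤ s := Finset.sum_nonneg fun t _ => hG0 t
  -- The errors cost 10/192 and the smoothness term 1/8 of γ s, leaving more than 5/16. The ε terms
  -- total 22/96 ≤ 1/4 of T γ ε, where T = q K.
  have h1 := mul_le_mul_of_nonneg_left hsum (by positivity : 0 ≤ 2 * γ)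
  have h2 : γ * (ε / 8) * s ≤ γ * (1 / 8) * s := by gcongr
  have h3 : 0 ≤ γ * s := by positivity
  have h4 : 0 ≤ ((q * K : ℕ) : ℝ) * γ * ε := by positivity
  linarith

end Convergence

/-! ### The convergence bound and the choice of parameters. -/

section Complexity

/-- The expected gradient norm at the uniformly chosen iterate is the average over the iterates. -/
lemma lintegral_gradient_uniform_iterate {d : ℕ} {S Ω : Type*} [MeasurableSpace S]
    [MeasurableSpace Ω] {P : Measure S} {μ : Measure Ω} [IsProbabilityMeasure μ]
    {F : S → EuclideanSpace ℝ (Fin d) → ℝ} {W₀ : Ω → EuclideanSpace ℝ (Fin d)}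
    {ξ : ℕ → ℕ → Ω → S} {τ : Ω → ℕ} {α L₀ L₁ γ : ℝ} {q B B' T : ℕ}
    (h : IsExpectedSymSmooth P F α L₀ L₁) (hr : IsRandomInput P μ W₀ ξ τ T) (hT : 0 < T)
    (hgi : ∀ t, Integrable
      (fun ω => ‖gradient (popLoss P F) (spiderIterate F γ q B B' W₀ ξ t ω)‖) μ) :
    Measurable (fun ω => ‖gradient (popLoss P F)
      (spider F γ q B B' (W₀ ω) (fun t i => ξ t i ω) (τ ω)).1‖) ∧
    ∫⁻ ω, ENNReal.ofReal ‖gradient (popLoss P F)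
      (spider F γ q B B' (W₀ ω) (fun t i => ξ t i ω) (τ ω)).1‖ ∂μ =
      ENNReal.ofReal ((T : ℝ)⁻¹ *
        ∑ t ∈ Finset.range T, meanGradNorm P μ F γ q B B' W₀ ξ t) := by
  have hT' : (0 : ℝ) < T := by exact_mod_cast hT
  set Ψ : ℕ → EuclideanSpace ℝ (Fin d) × (ℕ × ℕ → S) → ℝ := fun n x =>
    ‖gradient (popLoss P F) (spider F γ q B B' x.1 (fun t i => x.2 (t, i)) n).1‖ with hΨ
  have hΨm : Measurable (Function.uncurry Ψ) :=
    measurable_from_prod_countable_right fun n => (h.measurable_gradient_popLoss.comp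
      (measurable_spider_data h.measurable_uncurry_gradient n).fst).norm
  have hXm : Measurable fun ω => (W₀ ω, fun p : ℕ × ℕ => ξ p.1 p.2 ω) :=
    hr.measurable_init.prodMk (measurable_pi_lambda _ fun p => hr.measurable_sample _ _)
  have hcomp : Measurable fun ω => Function.uncurry Ψ
      (τ ω, (W₀ ω, fun p : ℕ × ℕ => ξ p.1 p.2 ω)) :=
    hΨm.comp (hr.measurable_index.prodMk hXm)
  refine ⟨by simpa only [Function.uncurry, Ψ] using hcomp, ?_⟩
  -- The index is independent of all the data, so it is frozen while the data are integrated.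
  have h1 := hr.indep_index.lintegral_eq hr.measurable_index hXm
    (Ψ := fun n x => ENNReal.ofReal (Ψ n x)) hΨm.ennreal_ofReal
  refine h1.trans ?_
  have h2 : ∀ n, ∫⁻ ω, ENNReal.ofReal (Ψ n (W₀ ω, fun p : ℕ × ℕ => ξ p.1 p.2 ω)) ∂μ =
      ENNReal.ofReal (meanGradNorm P μ F γ q B B' W₀ ξ n) := fun n =>
    (ofReal_integral_eq_lintegral_ofReal (hgi n) (.of_forall fun ω => norm_nonneg _)).symm
  simp only [h2]
  have hG0 : ∀ t, 0 ≤ meanGradNorm P μ F γ q B B' W₀ ξ t := fun t =>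
    integral_nonneg fun ω => norm_nonneg _
  rw [lintegral_uniform_index hr hT fun n =>
      ENNReal.ofReal (meanGradNorm P μ F γ q B B' W₀ ξ n),
    ← ENNReal.ofReal_sum_of_nonneg fun t _ => hG0 t,
    ENNReal.ofReal_mul (by positivity), ENNReal.ofReal_inv_of_pos hT', ENNReal.ofReal_natCast]

lemma average_le_of_sum_le {γ T s A ε : ℝ} (hγ : 0 < γ) (hT : 0 < T)
    (h : 5 / 16 * γ * s ≤ A + T * γ * ε / 4) :
    T⁻¹ * s ≤ 16 / (5 * T * γ) * A + 4 * ε / 5 := by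
  have e : 16 / (5 * T * γ) * A + 4 * ε / 5 = T⁻¹ * (16 / (5 * γ) * (A + T * γ * ε / 4)) := by
    field_simp
    ring
  rw [e]
  refine mul_le_mul_of_nonneg_left ?_ (by positivity)
  rw [div_mul_eq_mul_div, le_div_iff₀ (by positivity)]
  linarith

/-- The convergence bound of SPIDER at the uniformly chosen iterate. -/
lemma spider_convergence {d : ℕ} {S Ω : Type*} [MeasurableSpace S] [MeasurableSpace Ω]
    {P : Measure S} [IsProbabilityMeasure P] {μ : Measure Ω} [IsProbabilityMeasure μ]
    {F : S → EuclideanSpace ℝ (Fin d) → ℝ} {W₀ : Ω → EuclideanSpace ℝ (Fin d)}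
    {ξ : ℕ → ℕ → Ω → S} {τ : Ω → ℕ} {α L₀ L₁ Γ Λ ε : ℝ} {q B B' K : ℕ}
    (hα : 0 < α) (hα1 : α ≤ 1) (hL₀ : 0 < L₀) (hL₁ : 0 < L₁) (hΓ : 0 < Γ) (hΛ : 0 < Λ)
    (h : IsExpectedSymSmooth P F α L₀ L₁) (hv : HasUnbiasedBoundedVariance P F Γ Λ)
    (hbdd : BddBelow (Set.range (popLoss P F))) (hε : 0 < ε) (hε1 : ε < 1)
    (hq : 0 < q) (hK : 0 < K)
    (hB : max (576 * Λ ^ 2 / ε ^ 2) (2304 * Γ ^ 2 * (q : ℝ) ^ 2) ≤ (B : ℝ))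
    (hB' : max (576 * (q : ℝ)) (2304 * (q : ℝ) ^ 2 * ε ^ 2) ≤ (B' : ℝ))
    (hr : IsRandomInput P μ W₀ ξ τ (q * K))
    (hf0 : Integrable (fun ω => popLoss P F (W₀ ω)) μ) :
    Integrable (fun ω => ‖gradient (popLoss P F)
        (spider F (spiderStepsize α L₀ L₁ Γ Λ ε) q B B' (W₀ ω)
          (fun t i => ξ t i ω) (τ ω)).1‖) μ ∧
      ∫ ω, ‖gradient (popLoss P F)
        (spider F (spiderStepsize α L₀ L₁ Γ Λ ε) q B B' (W₀ ω)
          (fun t i => ξ t i ω) (τ ω)).1‖ ∂μ ≤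
        16 / (5 * ((q * K : ℕ) : ℝ) * spiderStepsize α L₀ L₁ Γ Λ ε) *
          (∫ ω, popLoss P F (W₀ ω) ∂μ - ⨅ w, popLoss P F w) + 4 * ε / 5 := by
  have hγ := spiderStepsize_pos (α := α) hL₀ hL₁ hΓ hΛ hε
  have H : IsGradLipschitzOnBalls P F (spiderStepsize α L₀ L₁ Γ Λ ε) ε := fun w w' hw =>
    gradDist_le_of_le_stepsize h hv hα hα1 hL₀ hL₁ hΓ hΛ hε hε1 hw
  generalize spiderStepsize α L₀ L₁ Γ Λ ε = γ at *
  have hT : 0 < q * K := Nat.mul_pos hq hK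
  have hT' : (0 : ℝ) < ((q * K : ℕ) : ℝ) := by exact_mod_cast hT
  have hsum := sum_meanGradNorm_le (K := K) H h hv hbdd hr hf0 hγ hε hε1 hΛ hq hB hB'
  have hgi := integrable_norm_gradient (q := q) (B := B) (B' := B') H h hv hbdd hr hf0 hγ hε hε1
  obtain ⟨hm, hlint⟩ := lintegral_gradient_uniform_iterate h hr hT hgi
  have hs0 : 0 ≤ ∑ t ∈ Finset.range (q * K), meanGradNorm P μ F γ q B B' W₀ ξ t :=
    Finset.sum_nonneg fun t _ => integral_nonneg fun ω => norm_nonneg _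
  have he0 := Filter.Eventually.of_forall (f := ae μ) fun ω => norm_nonneg (gradient (popLoss P F)
    (spider F γ q B B' (W₀ ω) (fun t i => ξ t i ω) (τ ω)).1)
  generalize ∑ t ∈ Finset.range (q * K), meanGradNorm P μ F γ q B B' W₀ ξ t = s at *
  refine ⟨⟨hm.aestronglyMeasurable, ?_⟩, ?_⟩
  · rw [hasFiniteIntegral_iff_ofReal he0, hlint]
    exact ENNReal.ofReal_lt_top
  · rw [integral_eq_lintegral_of_nonneg_ae he0 hm.aestronglyMeasurable, hlint,
      ENNReal.toReal_ofReal (mul_nonneg (inv_nonneg.2 hT'.le) hs0)]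
    exact average_le_of_sum_le hγ hT' hsum

lemma sum_batchSize_le {q : ℕ} (hq : 0 < q) (B B' K : ℕ) :
    ∑ t ∈ Finset.range (q * K), batchSize q B B' t ≤ K * (B + q * B') := by
  induction K with
  | zero => simp
  | succ K ih =>
    rw [Nat.mul_succ, Finset.sum_range_add, Nat.succ_mul]
    refine Nat.add_le_add ih ?_
    have h1 : ∀ j ∈ Finset.range q, batchSize q B B' (q * K + j) ≤
        (if j = 0 then B else 0) + B' := by
      intro j hj
      rw [batchSize, Nat.mul_add_mod, Nat.mod_eq_of_lt (Finset.mem_range.1 hj)]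
      split_ifs <;> omega
    refine (Finset.sum_le_sum h1).trans (le_of_eq ?_)
    rw [Finset.sum_add_distrib, Finset.sum_ite_eq' (Finset.range q) 0 fun _ => B]
    simp [hq]

/-- Parameters of order `q ∼ 1 / ε`, `B ∼ 1 / ε ^ 2`, `B' ∼ 1 / ε`, `K ∼ 1 / ε`. -/
lemma exists_spider_parameters (Γ Λ Δ : ℝ) {c : ℝ} (hc : 0 < c) :
    ∃ C : ℝ, 0 < C ∧ c ≤ C ∧ ∀ ε : ℝ, 0 < ε → ε < 1 → ∃ q B B' K : ℕ,
      0 < q ∧ 0 < K ∧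
      max (576 * Λ ^ 2 / ε ^ 2) (2304 * Γ ^ 2 * (q : ℝ) ^ 2) ≤ (B : ℝ) ∧
      max (576 * (q : ℝ)) (2304 * (q : ℝ) ^ 2 * ε ^ 2) ≤ (B' : ℝ) ∧
      (B : ℝ) ≤ C / ε ^ 2 ∧ (B' : ℝ) ≤ C / ε ∧ (q : ℝ) ≤ C / ε ∧
      ((q * K : ℕ) : ℝ) ≤ C / ε ^ 2 ∧
      ((∑ t ∈ Finset.range (q * K), batchSize q B B' t : ℕ) : ℝ) ≤ C / ε ^ 3 ∧
      16 * Δ ≤ ε * (((q * K : ℕ) : ℝ) * (c * ε)) := by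
  set D := max Δ 0 with hD
  have hD0 : 0 ≤ D := le_max_right _ _
  -- Since q ≤ 2/ε, the factor 9216 is 4 · 2304; likewise 10369 = 1152 + 9216 + 1 below serves for
  -- B'. The final 1 absorbs rounding up.
  set CB : ℝ := 576 * Λ ^ 2 + 9216 * Γ ^ 2 + 1 with hCB
  set CK : ℝ := 16 * D / c + 2 with hCK
  have hCB0 : 0 < CB := by positivity
  have hCK0 : 0 < CK := by positivity
  refine ⟨CB + 10369 + 2 + c + 2 * CK + CK * (CB + 2 * 10369), by positivity, ?_, ?_⟩
  · have : 0 ≤ CK * (CB + 2 * 10369) := by positivity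
    linarith
  intro ε hε hε1
  set C := CB + 10369 + 2 + c + 2 * CK + CK * (CB + 2 * 10369) with hC
  have hCK' : 0 ≤ CK * (CB + 2 * 10369) := by positivity
  have hinv : 1 ≤ 1 / ε := by rw [le_div_iff₀ hε]; linarith
  have hinv2 : 1 ≤ 1 / ε ^ 2 := by rw [le_div_iff₀ (by positivity)]; nlinarith
  set q := ⌈1 / ε⌉₊ with hq
  have hq1 : 1 / ε ≤ q := Nat.le_ceil _
  have hq2 : (q : ℝ) ≤ 2 / ε := by
    have := (Nat.ceil_lt_add_one (by positivity : 0 ≤ 1 / ε)).le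
    have e : 2 / ε = 1 / ε + 1 / ε := by ring
    rw [e]
    linarith
  have hqε : (q : ℝ) * ε ≤ 2 := by rwa [le_div_iff₀ hε] at hq2
  have hq0 : (0 : ℝ) < q := by linarith
  have hqpos : 0 < q := by exact_mod_cast hq0
  set B := ⌈max (576 * Λ ^ 2 / ε ^ 2) (2304 * Γ ^ 2 * (q : ℝ) ^ 2)⌉₊ with hB
  set B' := ⌈max (576 * (q : ℝ)) (2304 * (q : ℝ) ^ 2 * ε ^ 2)⌉₊ with hB'
  -- Together with q ≥ 1/ε this makes q K c ε² at least 16 D. The extra 1 keeps K positive when D =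
  -- 0.
  set K := ⌈16 * D / (c * ε)⌉₊ + 1 with hK
  have hqsq : (q : ℝ) ^ 2 ≤ 4 / ε ^ 2 := by
    have e : 4 / ε ^ 2 = (2 / ε) ^ 2 := by rw [div_pow]; norm_num
    rw [e]
    gcongr
  have hBle : (B : ℝ) ≤ CB / ε ^ 2 := by
    have h1 := (Nat.ceil_lt_add_one (le_max_of_le_left (c := 2304 * Γ ^ 2 * (q : ℝ) ^ 2)
      (by positivity : 0 ≤ 576 * Λ ^ 2 / ε ^ 2))).le
    have h2 : max (576 * Λ ^ 2 / ε ^ 2) (2304 * Γ ^ 2 * (q : ℝ) ^ 2) ≤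
        576 * Λ ^ 2 / ε ^ 2 + 2304 * Γ ^ 2 * (4 / ε ^ 2) := by
      refine max_le (by linarith [show 0 ≤ 2304 * Γ ^ 2 * (4 / ε ^ 2) by positivity]) ?_
      have : 2304 * Γ ^ 2 * (q : ℝ) ^ 2 ≤ 2304 * Γ ^ 2 * (4 / ε ^ 2) := by gcongr
      linarith [show 0 ≤ 576 * Λ ^ 2 / ε ^ 2 by positivity]
    have e : CB / ε ^ 2 = 576 * Λ ^ 2 / ε ^ 2 + 2304 * Γ ^ 2 * (4 / ε ^ 2) + 1 / ε ^ 2 := by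
      rw [hCB]; ring
    rw [e]
    linarith
  have hBle' : (B' : ℝ) ≤ 10369 / ε := by
    have h1 := (Nat.ceil_lt_add_one (le_max_of_le_left (c := 2304 * (q : ℝ) ^ 2 * ε ^ 2)
      (by positivity : 0 ≤ 576 * (q : ℝ)))).le
    have h2 : max (576 * (q : ℝ)) (2304 * (q : ℝ) ^ 2 * ε ^ 2) ≤ 1152 * (1 / ε) + 9216 := by
      refine max_le ?_ ?_
      · have : 576 * (q : ℝ) ≤ 576 * (2 / ε) := by gcongr
        have e : 576 * (2 / ε) = 1152 * (1 / ε) := by ring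
        linarith
      · have : (q * ε) ^ 2 ≤ 2 ^ 2 := by gcongr
        nlinarith
    have e : 10369 / ε = 10369 * (1 / ε) := by ring
    rw [e]
    linarith
  have hKle : (K : ℝ) ≤ CK / ε := by
    have h1 := (Nat.ceil_lt_add_one (by positivity : 0 ≤ 16 * D / (c * ε))).le
    have e : CK / ε = 16 * D / (c * ε) + 2 * (1 / ε) := by
      rw [hCK]; field_simp
    rw [e, hK]
    push_cast
    linarith
  have hKge : 16 * D / (c * ε) ≤ K := by
    have := Nat.le_ceil (16 * D / (c * ε))
    rw [hK]
    push_cast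
    linarith
  refine ⟨q, B, B', K, hqpos, Nat.succ_pos _, Nat.le_ceil _, Nat.le_ceil _,
    hBle.trans ?_, hBle'.trans ?_, hq2.trans ?_, ?_, ?_, ?_⟩
  · gcongr; linarith
  · gcongr; linarith
  · gcongr; linarith
  · push_cast
    calc (q : ℝ) * K ≤ 2 / ε * (CK / ε) := by gcongr
      _ = 2 * CK / ε ^ 2 := by ring
      _ ≤ C / ε ^ 2 := by gcongr; linarith
  · have h1 : ((∑ t ∈ Finset.range (q * K), batchSize q B B' t : ℕ) : ℝ) ≤
        K * (B + q * B') := by exact_mod_cast sum_batchSize_le hqpos B B' K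
    refine h1.trans ?_
    calc (K : ℝ) * (B + q * B') ≤ CK / ε * (CB / ε ^ 2 + 2 / ε * (10369 / ε)) := by gcongr
      _ = CK * (CB + 2 * 10369) / ε ^ 3 := by ring
      _ ≤ C / ε ^ 3 := by gcongr; linarith
  · have h1 : 16 * D / (c * ε) * (1 / ε) ≤ (K : ℝ) * q := by gcongr
    have h2 : 16 * D = ε * (16 * D / (c * ε) * (1 / ε) * (c * ε)) := by field_simp
    push_cast
    calc 16 * Δ ≤ 16 * D := by linarith [le_max_left Δ 0]
      _ = ε * (16 * D / (c * ε) * (1 / ε) * (c * ε)) := h2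
      _ ≤ ε * ((K : ℝ) * q * (c * ε)) := by gcongr
      _ = _ := by ring

end Complexity

end

theorem theorem4 (α L₀ L₁ Γ Λ : ℝ) (hα : 0 < α) (hα1 : α ≤ 1) (hL₀ : 0 < L₀) (hL₁ : 0 < L₁)
    (hΓ : 0 < Γ) (hΛ : 0 < Λ) :
    -- the convergence bound
    (∀ (d : ℕ) (S Ω : Type*) [MeasurableSpace S] [MeasurableSpace Ω]
      (P : Measure S) [IsProbabilityMeasure P] (μ : Measure Ω) [IsProbabilityMeasure μ]
      (F : S → EuclideanSpace ℝ (Fin d) → ℝ)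
      (W₀ : Ω → EuclideanSpace ℝ (Fin d)) (ξ : ℕ → ℕ → Ω → S) (τ : Ω → ℕ)
      (ε : ℝ) (q B B' K : ℕ),
      IsExpectedSymSmooth P F α L₀ L₁ →
      HasUnbiasedBoundedVariance P F Γ Λ →
      BddBelow (Set.range (popLoss P F)) →
      0 < ε → ε < 1 → 0 < q → 0 < K →
      max (576 * Λ ^ 2 / ε ^ 2) (2304 * Γ ^ 2 * (q : ℝ) ^ 2) ≤ (B : ℝ) →
      max (576 * (q : ℝ)) (2304 * (q : ℝ) ^ 2 * ε ^ 2) ≤ (B' : ℝ) →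
      IsRandomInput P μ W₀ ξ τ (q * K) →
      Integrable (fun ω => popLoss P F (W₀ ω)) μ →
      Integrable (fun ω => ‖gradient (popLoss P F)
        (spider F (spiderStepsize α L₀ L₁ Γ Λ ε) q B B' (W₀ ω)
          (fun t i => ξ t i ω) (τ ω)).1‖) μ ∧
      ∫ ω, ‖gradient (popLoss P F)
        (spider F (spiderStepsize α L₀ L₁ Γ Λ ε) q B B' (W₀ ω)
          (fun t i => ξ t i ω) (τ ω)).1‖ ∂μ ≤
        16 / (5 * ((q * K : ℕ) : ℝ) * spiderStepsize α L₀ L₁ Γ Λ ε) *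
          (∫ ω, popLoss P F (W₀ ω) ∂μ - ⨅ w, popLoss P F w) + 4 * ε / 5) ∧
    -- the parameter choices and the sample complexity, with a constant `C` that depends only on
    -- `α, L₀, L₁, Γ, Λ` and a bound `Δ` of the initial gap
    (∀ Δ : ℝ, ∃ C : ℝ, 0 < C ∧ ∀ ε : ℝ, 0 < ε → ε < 1 → ∃ q B B' K : ℕ,
      0 < q ∧ 0 < K ∧
      max (576 * Λ ^ 2 / ε ^ 2) (2304 * Γ ^ 2 * (q : ℝ) ^ 2) ≤ (B : ℝ) ∧
      max (576 * (q : ℝ)) (2304 * (q : ℝ) ^ 2 * ε ^ 2) ≤ (B' : ℝ) ∧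
      (B : ℝ) ≤ C / ε ^ 2 ∧ (B' : ℝ) ≤ C / ε ∧ (q : ℝ) ≤ C / ε ∧
      spiderStepsize α L₀ L₁ Γ Λ ε ≤ C * ε ∧ ((q * K : ℕ) : ℝ) ≤ C / ε ^ 2 ∧
      ((∑ t ∈ Finset.range (q * K), batchSize q B B' t : ℕ) : ℝ) ≤ C / ε ^ 3 ∧
      ∀ (d : ℕ) (S Ω : Type*) [MeasurableSpace S] [MeasurableSpace Ω]
        (P : Measure S) [IsProbabilityMeasure P] (μ : Measure Ω) [IsProbabilityMeasure μ]
        (F : S → EuclideanSpace ℝ (Fin d) → ℝ)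
        (W₀ : Ω → EuclideanSpace ℝ (Fin d)) (ξ : ℕ → ℕ → Ω → S) (τ : Ω → ℕ),
        IsExpectedSymSmooth P F α L₀ L₁ →
        HasUnbiasedBoundedVariance P F Γ Λ →
        BddBelow (Set.range (popLoss P F)) →
        IsRandomInput P μ W₀ ξ τ (q * K) →
        Integrable (fun ω => popLoss P F (W₀ ω)) μ →
        ∫ ω, popLoss P F (W₀ ω) ∂μ - ⨅ w, popLoss P F w ≤ Δ →
        Integrable (fun ω => ‖gradient (popLoss P F)
          (spider F (spiderStepsize α L₀ L₁ Γ Λ ε) q B B' (W₀ ω)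
            (fun t i => ξ t i ω) (τ ω)).1‖) μ ∧
        ∫ ω, ‖gradient (popLoss P F)
          (spider F (spiderStepsize α L₀ L₁ Γ Λ ε) q B B' (W₀ ω)
            (fun t i => ξ t i ω) (τ ω)).1‖ ∂μ ≤ ε) := by
  refine ⟨?_, ?_⟩
  · intro d S Ω _ _ P _ μ _ F W₀ ξ τ ε q B B' K h hv hbdd hε hε1 hq hK hB hB' hr hf0
    exact spider_convergence hα hα1 hL₀ hL₁ hΓ hΛ h hv hbdd hε hε1 hq hK hB hB' hr hf0
  · intro Δ
    have hc : 0 < stepsizeFactor α L₀ L₁ Γ Λ := stepsizeFactor_pos hL₀ hL₁ hΓ hΛ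
    obtain ⟨C, hC, hcC, hpar⟩ := exists_spider_parameters Γ Λ Δ hc
    refine ⟨C, hC, fun ε hε hε1 => ?_⟩
    obtain ⟨q, B, B', K, hq, hK, hB, hB', h1, h2, h3, h4, h5, hT⟩ := hpar ε hε hε1
    refine ⟨q, B, B', K, hq, hK, hB, hB', h1, h2, h3, ?_, h4, h5, ?_⟩
    · rw [spiderStepsize_eq]
      gcongr
    · intro d S Ω _ _ P _ μ _ F W₀ ξ τ h hv hbdd hr hf0 hΔ
      have hconv := spider_convergence hα hα1 hL₀ hL₁ hΓ hΛ h hv hbdd hε hε1 hq hK hB hB' hr hf0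
      refine ⟨hconv.1, hconv.2.trans ?_⟩
      have hTpos : (0 : ℝ) < ((q * K : ℕ) : ℝ) := by exact_mod_cast Nat.mul_pos hq hK
      rw [← spiderStepsize_eq] at hT
      have hγ := spiderStepsize_pos (α := α) hL₀ hL₁ hΓ hΛ hε
      -- The choice of K gives 16 Δ ≤ ε T γ with T = q K, so the initial gap uses exactly the ε/5
      -- left over by 4ε/5.
      have hgap : 16 / (5 * ((q * K : ℕ) : ℝ) * spiderStepsize α L₀ L₁ Γ Λ ε) *
          (∫ ω, popLoss P F (W₀ ω) ∂μ - ⨅ w, popLoss P F w) ≤ ε / 5 := by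
        rw [div_mul_eq_mul_div, div_le_iff₀ (by positivity)]
        linarith
      linarith
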